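/- Let $G=(\mathcal V,\mathcal E)$ be a finite connected simple graph with $n=|\mathcal V|$ nodes, with symmetric edge weights $w_{xy}=w_{yx}>0$ for $x\sim y$ and $w_{xy}=0$ otherwise, and with a $\mathrm U(1)$-connection, that is, a unit complex number $\phi_{xy}$ for each oriented edge $xy$, with $\phi_{yx}=\overline{\phi_{xy}}$. Let $\deg(x)=\sum_y w_{xy}$, let $\mathsf D=\mathrm{diag}(\deg)$, $\mathsf W=(w_{xy})$, $\mathsf\Phi=(\phi_{xy})$ (with zero entries off the edges), and let $\mathsf\Pi=\mathsf D^{-1}(\mathsf W\odot\mathsf\Phi)$, where $\odot$ is the entrywise product. An oriented cycle is a closed path $c=(x_0,\dots,x_{k-1},x_0)$ along the edges of $G$, with $k\ge 2$ and $x_0,\dots,x_{k-1}$ distinct, up to the choice of its base node (backtracks, $k=2$, are included). Its holonomy is $\mathrm{hol}(c)=\phi_{x_0x_1}\cdots\phi_{x_{k-1}x_0}=e^{-\mathrm i\theta(c)}$. Assume that $\mathrm{hol}(c)\ne 1$ for at least one oriented cycle $c$ and that $\cos\theta(c)\ge 0$ for all oriented cycles $c$. The algorithm CyclePopping, with cycle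 weights $\alpha(c)=1-\cos\theta(c)$ and a fixed ordering of the nodes, uses the following independent random objects: for each $x\in\mathcal V$, a Markov chain $(X^x_k)_{k\ge 0}$ on $\mathcal V$ with $X^x_0=x$ and transition probabilities $p_{yz}=w_{yz}/\deg(y)$; and, for each $x\in\mathcal V$, each oriented cycle $c$ and each $k\ge 0$, a Bernoulli variable $B^x_{c,k}$ of parameter $\alpha(c)$. It starts from $\mathcal V_0=\emptyset$. While $\mathcal V_\ell\ne\mathcal V$, it takes the first node $x$ in the ordering that is not in $\mathcal V_\ell$ and runs $(X^x_k)_{k\geq 0}$, keeping track of the loop-erased path from $x$. Whenever a step $k$ leads to a node of the current loop-erased path, and so closes an oriented cycle $c$, this cycle is accepted if $B^x_{c,k}=1$ and is erased from the path otherwise. The walk stops as soon as it hits $\mathcal V_\ell$ or a cycle is accepted; the nodes of the resulting branch or lasso are added to $\mathcal V_\ell$ to form $\mathcal V_{\ell+1}$. Let $T\in\mathbb N\cup\{\infty\}$ be the running time, that is, the total number of steps made by the walks until $\mathcal V_\ell=\mathcal V$. Then $T<\infty$ almost surely, $\mathbb I-t\mathsf\Pi$ is invertible for all $t\in[-1,1]$,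 and, for all $t\in[-1,1]$, $$\mathbb E[t^T]=t^n\det\left(\mathbb I+(1-t)\,\mathsf\Pi(\mathbb I-\mathsf\Pi)^{-1}\right)^{-1}=t^n\,\frac{\det(\mathbb I-\mathsf\Pi)}{\det(\mathbb I-t\mathsf\Pi)}.$$ -/

import Mathlib

open MeasureTheory ProbabilityTheory
open scoped Matrix ENNReal

noncomputable section

/-- A simple graph with symmetric positive edge weights `w` and a
`U(1)`-connection `φ`: a unit complex number `φ x y` on each oriented edge `xy`, with
`φ y x` the inverse (equivalently, the conjugate) of `φ x y`.
The values of `φ` off the edges are irrelevant. -/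
structure ConnectionGraph (V : Type*) where
  graph : SimpleGraph V
  w : V → V → ℝ
  w_symm : ∀ x y, w x y = w y x
  w_pos : ∀ x y, graph.Adj x y → 0 < w x y
  w_zero : ∀ x y, ¬ graph.Adj x y → w x y = 0
  φ : V → V → Circle
  φ_inv : ∀ x y, graph.Adj x y → φ y x = (φ x y)⁻¹

namespace ConnectionGraph

section Matrices

variable {V : Type*} [Fintype V] (G : ConnectionGraph V)

/-- The weighted degree of a node. -/
def deg (x : V) : ℝ := ∑ y, G.w x y

/-- The transition probability `w_{xy} / deg(x)` of the random walk. -/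
def p (x y : V) : ℝ := G.w x y / G.deg x

/-- The weight matrix `W`, with complex coefficients. -/
def wMatrix : Matrix V V ℂ := Matrix.of fun x y => (G.w x y : ℂ)

open Classical in
/-- The matrix `Φ` of the phases: `φ x y` on the edges and zero elsewhere. -/
def phaseMatrix : Matrix V V ℂ :=
  Matrix.of fun x y => if G.graph.Adj x y then (G.φ x y : ℂ) else 0

/-- The diagonal matrix `D` of the degrees. -/
def degMatrix [DecidableEq V] : Matrix V V ℂ := Matrix.diagonal fun x => (G.deg x : ℂ)

/-- The connection-aware transition matrix `Π = D⁻¹ (W ⊙ Φ)`. -/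
def transitionMatrix [DecidableEq V] : Matrix V V ℂ :=
  (G.degMatrix)⁻¹ * (G.wMatrix ⊙ G.phaseMatrix)

end Matrices

section Cycles

variable {V : Type*} (G : ConnectionGraph V)

/-- Oriented cycles `(x₀, …, x_{k-1}, x₀)` with `k ≥ 2` distinct nodes, consecutive nodes being
adjacent, up to the choice of the base node. Backtracks (`k = 2`) are included. -/
def OrientedCycle : Type _ :=
  {c : Cycle V // c.Nodup ∧ 2 ≤ c.length ∧ c.Chain G.graph.Adj}

/-- The holonomy `φ_{x₀x₁} φ_{x₁x₂} ⋯ φ_{x_{k-1}x₀}` of the based loop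
`(x₀, x₁, …, x_{k-1}, x₀)`, given by the list `[x₀, …, x_{k-1}]`. -/
def listHol (l : List V) : Circle := (List.zipWith G.φ l (l.rotate 1)).prod

theorem listHol_rotate (l : List V) (k : ℕ) : G.listHol (l.rotate k) = G.listHol l := by
  unfold listHol
  rw [List.rotate_rotate, Nat.add_comm k 1, ← List.rotate_rotate,
    ← List.zipWith_rotate_distrib _ _ _ _ (by simp)]
  exact (List.rotate_perm _ _).prod_eq

variable {G}

/-- The holonomy of an oriented cycle. -/
def OrientedCycle.hol (c : G.OrientedCycle) : Circle :=
  Quotient.lift (s := List.IsRotated.setoid V) G.listHol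
    (by
      rintro a b ⟨k, rfl⟩
      exact (G.listHol_rotate a k).symm) c.1

/-- The angle `θ(c)` of an oriented cycle, defined modulo `2π` by `hol(c) = exp(-i θ(c))`. -/
def OrientedCycle.angle (c : G.OrientedCycle) : ℝ := -Complex.arg (c.hol : ℂ)

theorem OrientedCycle.hol_eq (c : G.OrientedCycle) :
    (c.hol : ℂ) = Complex.exp (-(Complex.I * (c.angle : ℂ))) := by
  conv_lhs => rw [← Circle.exp_arg c.hol]
  rw [Circle.coe_exp, angle]
  congr 1
  push_cast
  ring

end Cycles

section Algorithm

variable {V : Type*} [DecidableEq V]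

/-- The chronological loop erasure of `(ξ 0, …, ξ n)`, as a list of distinct nodes from `ξ 0` to
`ξ n`. When the walk steps to a node `y` of the current self-avoiding path, the loop formed at `y`
is erased; otherwise, `y` is appended to the path. -/
def loopErased (ξ : ℕ → V) : ℕ → List V
  | 0 => [ξ 0]
  | n + 1 => (loopErased ξ n).takeWhile (fun v => v ≠ ξ (n + 1)) ++ [ξ (n + 1)]

variable (G : ConnectionGraph V)

/-- The `n`-th step of the walk `ξ` closes the oriented cycle `c` with the current loop-erased
path. -/
def Closes (ξ : ℕ → V) (c : G.OrientedCycle) : ℕ → Prop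
  | 0 => False
  | n + 1 => c.1 = (((loopErased ξ n).dropWhile (fun v => v ≠ ξ (n + 1)) : List V) : Cycle V)

/-- The first time when the walk is in `A` (`⊤` if there is none). -/
def hitTime (A : Finset V) (ξ : ℕ → V) : ℕ∞ := ⨅ (n : ℕ) (_ : ξ n ∈ A), (n : ℕ∞)

/-- The first time when the walk closes the cycle `c` and accepts it (`⊤` if there is none). -/
def cycleTime (ξ : ℕ → V) (b : G.OrientedCycle → ℕ → Bool) (c : G.OrientedCycle) : ℕ∞ :=
  ⨅ (n : ℕ) (_ : G.Closes ξ c n ∧ b c n = true), (n : ℕ∞)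

/-- The first time when the walk hits `A` or accepts a cycle. -/
def stopTime (A : Finset V) (ξ : ℕ → V) (b : G.OrientedCycle → ℕ → Bool) : ℕ∞ :=
  hitTime A ξ ⊓ ⨅ c, G.cycleTime ξ b c

/-- The node of least index outside `A`, for the ordering `ι` (`none` if there is none). -/
def nextNode [Fintype V] (ι : Fin (Fintype.card V) ≃ V) (A : Finset V) : Option V :=
  (Fin.find? fun k => decide (ι k ∉ A)).map ι

/-- The set `V_ℓ` of the nodes of the subgraph built by the first `ℓ` iterations of CyclePopping,
run with the walks `ξ x` started at the nodes `x` and with the acceptance variables `b x c n`.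
An iteration adds the nodes of the branch or lasso obtained by erasing the loops of the walk up to
its stopping time `τ`: these are the nodes of the loop-erased path at time `τ - 1`, the last step
leading either to that path or to `V_ℓ`. (If `τ = ⊤`, the algorithm does not terminate and the
later sets are meaningless.) -/
def nodes [Fintype V] (ι : Fin (Fintype.card V) ≃ V) (ξ : V → ℕ → V)
    (b : V → G.OrientedCycle → ℕ → Bool) : ℕ → Finset V
  | 0 => ∅
  | ℓ + 1 =>
    let A := nodes ι ξ b ℓ
    match nextNode ι A with
    | none => A
    | some x => A ∪ (loopErased (ξ x) ((G.stopTime A (ξ x) (b x)).toNat - 1)).toFinset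

/-- The number of steps made by the walk in iteration `ℓ` (counted from zero); zero if the
algorithm has already terminated, `⊤` if the walk never stops. -/
def iterSteps [Fintype V] (ι : Fin (Fintype.card V) ≃ V) (ξ : V → ℕ → V)
    (b : V → G.OrientedCycle → ℕ → Bool) (ℓ : ℕ) : ℕ∞ :=
  match nextNode ι (G.nodes ι ξ b ℓ) with
  | none => 0
  | some x => G.stopTime (G.nodes ι ξ b ℓ) (ξ x) (b x)

/-- The running time of CyclePopping: the total number of steps of the walks. Each
iteration adds at least one node, so that there are at most `|V|` of them. -/
def runningTime [Fintype V] (ι : Fin (Fintype.card V) ≃ V) (ξ : V → ℕ → V)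
    (b : V → G.OrientedCycle → ℕ → Bool) : ℕ∞ :=
  ∑ ℓ ∈ Finset.range (Fintype.card V), G.iterSteps ι ξ b ℓ

end Algorithm

/-- The randomness of CyclePopping: under `P`, for each node `x`, a Markov chain `X x`
started at `x` with transition probabilities `p`, and for each node `x` and oriented cycle `c` an
i.i.d. stream `B x c n` of Bernoulli variables of parameter `α c`; all the chains
and all the Bernoulli variables are mutually independent. -/
structure IsInput {V : Type*} [Fintype V] [MeasurableSpace V] (G : ConnectionGraph V)
    (α : G.OrientedCycle → ℝ) {Ω : Type*} [MeasurableSpace Ω] (P : Measure Ω)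
    (X : V → ℕ → Ω → V) (B : V → G.OrientedCycle → ℕ → Ω → Bool) : Prop where
  measurable_X : ∀ x n, Measurable (X x n)
  measurable_B : ∀ x c n, Measurable (B x c n)
  start : ∀ x, ∀ᵐ ω ∂P, X x 0 ω = x
  chain : ∀ x n (ξ : ℕ → V), ξ 0 = x →
    P {ω | ∀ k ≤ n, X x k ω = ξ k} =
      ENNReal.ofReal (∏ k ∈ Finset.range n, G.p (ξ k) (ξ (k + 1)))
  bernoulli : ∀ x c n, P {ω | B x c n ω = true} = ENNReal.ofReal (α c)
  indep_X : iIndepFun (fun x ω n => X x n ω) P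
  indep_B : iIndepFun (fun (i : V × G.OrientedCycle × ℕ) ω => B i.1 i.2.1 i.2.2 ω) P
  indep_XB : IndepFun (fun ω x n => X x n ω) (fun ω x c n => B x c n ω) P

end ConnectionGraph

end

/-! While a walk runs in S = V ∖ V_ℓ, its loop-erased path is a Markov chain on the self-avoiding
paths of S, killed when the walk leaves S or accepts a cycle; a closed cycle c is survived with
probability cos θ(c) ∈ [0, 1]. Let D_t(S) be the principal minor det(I - tΠ)_S (`cycleDet`).
Expanding it along the cycles through x (`principalDet_eq_sub`) and pairing each cycle with its
reversal, whose weight is the complex conjugate, gives D_t(S) = D_t(S∖x) - Σ_{c∋x} t^|c| p(c) cos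
θ(c) D_t(S∖c), with the very weights that the chain gives to its erased cycles.

Hence the Green function of the chain is explicit: the generating function of the visits to γ, for
the walk from x, is t^(|γ|-1) p(γ) D_t(S∖γ) / D_t(S), where |γ| counts nodes
(`vecMul_one_sub_pathMatrix`). This is licit for all |t| ≤ 1 because the chain is transient
(`isTransient_pathMatrix`): if no mass were lost, the walk could follow a cycle of non-trivial
holonomy and close it with survival probability 1. Transience also yields D_t(S) ≠ 0.

The stopping step costs one more t, so an iteration that ends with γ contributes t^|γ| p(γ) D_t(S∖γ)
/ D_t(S) times an exit probability free of t. The next iterations use independent inputs and, by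
induction, contribute t^|S∖γ| D_1(S∖γ) / D_t(S∖γ) (`hasSum_remainingProb`). The factors D_t(S∖γ)
cancel, the powers of t combine to t^|S|, and the sum over γ is D_1(S)
(`sum_pathWeight_mul_exitProb`). For S = V this is the claimed formula; its value 1 at t = 1 says
that T is almost surely finite. -/

noncomputable section

namespace ConnectionGraph

/-! ### Self-avoiding paths and products along paths. -/

section NodupLists

variable {V : Type*} [Fintype V] [DecidableEq V]

/-- The lists of distinct elements of `S`. -/
def nodupLists (S : Finset V) : Finset (List V) :=
  ((Finset.univ : Finset {l : List V // l.Nodup}).map (Function.Embedding.subtype _)).filter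
    fun l => ∀ v ∈ l, v ∈ S

theorem mem_nodupLists {S : Finset V} {l : List V} :
    l ∈ nodupLists S ↔ l.Nodup ∧ ∀ v ∈ l, v ∈ S := by
  simp [nodupLists]

theorem sum_nodupLists {M : Type*} [AddCommMonoid M] (S : Finset V) (f : List V → M) :
    ∑ l ∈ nodupLists S, f l =
      f [] + ∑ y ∈ S, ∑ l ∈ nodupLists (S.erase y), f (y :: l) := by
  have h : nodupLists S = insert []
      (S.biUnion fun y => (nodupLists (S.erase y)).map ⟨List.cons y, List.cons_injective⟩) := by
    ext l
    cases l with
    | nil => simp [mem_nodupLists]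
    | cons y l =>
      simp only [mem_nodupLists, List.nodup_cons, List.mem_cons, forall_eq_or_imp,
        Finset.mem_insert, Finset.mem_biUnion, Finset.mem_map,
        Function.Embedding.coeFn_mk, Finset.mem_erase, reduceCtorEq, false_or, List.cons.injEq]
      constructor
      · rintro ⟨⟨h1, h2⟩, h3, h4⟩
        exact ⟨y, h3, l, ⟨h2, fun v hv => ⟨fun h => h1 (h ▸ hv), h4 v hv⟩⟩, rfl, rfl⟩
      · rintro ⟨y', h3, l', ⟨h2, h4⟩, rfl, rfl⟩
        exact ⟨⟨fun h => (h4 _ h).1 rfl, h2⟩, h3, fun v hv => (h4 v hv).2⟩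
  rw [h, Finset.sum_insert (by simp), Finset.sum_biUnion]
  · simp
  · intro y _ y' _ hyy'
    rw [Function.onFun, Finset.disjoint_left]
    simp only [Finset.mem_map, Function.Embedding.coeFn_mk, not_exists, not_and]
    rintro _ ⟨l, _, rfl⟩ l' _ h
    exact hyy' (List.cons.inj h).1.symm

end NodupLists

section ChainProd

variable {V M : Type*}

/-- The product `f z l₁ * f l₁ l₂ * ⋯` along the path `z :: l`. -/
def chainProd [Monoid M] (f : V → V → M) : V → List V → M
  | _, [] => 1
  | z, y :: l => f z y * chainProd f y l

@[simp]
theorem chainProd_nil [Monoid M] (f : V → V → M) (z : V) : chainProd f z [] = 1 := rfl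

@[simp]
theorem chainProd_cons [Monoid M] (f : V → V → M) (z y : V) (l : List V) :
    chainProd f z (y :: l) = f z y * chainProd f y l := rfl

theorem chainProd_append [Monoid M] (f : V → V → M) (z v : V) (l l' : List V) :
    chainProd f z (l ++ v :: l') = chainProd f z (l ++ [v]) * chainProd f v l' := by
  induction l generalizing z with
  | nil => simp
  | cons y l ih => rw [List.cons_append, chainProd_cons, ih, List.cons_append, chainProd_cons,
      mul_assoc]

theorem chainProd_concat [Monoid M] (f : V → V → M) {z y : V} {l : List V}
    (h : (z :: l).getLast? = some y) (v : V) :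
    chainProd f z (l ++ [v]) = chainProd f z l * f y v := by
  induction l generalizing z with
  | nil => simp at h; simp [h]
  | cons x l ih =>
    rw [List.getLast?_cons_cons] at h
    rw [List.cons_append, chainProd_cons, ih h, chainProd_cons, mul_assoc]

theorem chainProd_mul [CommMonoid M] (f g : V → V → M) (z : V) (l : List V) :
    chainProd (fun u v => f u v * g u v) z l = chainProd f z l * chainProd g z l := by
  induction l generalizing z with
  | nil => simp
  | cons y l ih => simp only [chainProd_cons, ih, mul_mul_mul_comm]

theorem map_chainProd [Monoid M] {N : Type*} [Monoid N] (h : M →* N) (f : V → V → M) (z : V)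
    (l : List V) : h (chainProd f z l) = chainProd (fun u v => h (f u v)) z l := by
  induction l generalizing z with
  | nil => simp
  | cons y l ih => simp only [chainProd_cons, map_mul, ih]

theorem chainProd_const [Monoid M] (c : M) (z : V) (l : List V) :
    chainProd (fun _ _ => c) z l = c ^ l.length := by
  induction l generalizing z with
  | nil => simp
  | cons y l ih => simp [ih, pow_succ']

theorem chainProd_reverse [CommMonoid M] (f : V → V → M) (x z : V) (l : List V) :
    chainProd f z (l.reverse ++ [x]) = chainProd (fun u v => f v u) x (l ++ [z]) := by
  induction l generalizing x with
  | nil => simp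
  | cons y l ih =>
    rw [List.reverse_cons, List.append_assoc, List.singleton_append, chainProd_append, ih]
    simp [mul_comm]

/-- On a closed path, factors attached to the starting nodes of the edges depend only on the nodes
visited; this makes the degrees invariant under reversal. -/
theorem chainProd_left [CommMonoid M] (g : V → M) (x z : V) (l : List V) :
    chainProd (fun u _ => g u) z (l ++ [x]) = g z * (l.map g).prod := by
  induction l generalizing z with
  | nil => simp
  | cons y l ih => simp [ih]

end ChainProd

/-! ### Expansion of principal minors of I - a along cycles. -/

section PrincipalDet

variable {V : Type*} [Fintype V] [DecidableEq V] {R : Type*} [CommRing R]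

/-- The matrix `1 - a` with the rows outside `S` replaced by those of the identity. -/
def principalMatrix (a : Matrix V V R) (S : Finset V) : Matrix V V R :=
  Matrix.of fun y => if y ∈ S then Pi.single y 1 - a y else Pi.single y 1

/-- The determinant of the principal submatrix of `1 - a` indexed by `S`. -/
def principalDet (a : Matrix V V R) (S : Finset V) : R := (principalMatrix a S).det

theorem principalDet_empty (a : Matrix V V R) : principalDet a ∅ = 1 := by
  have : principalMatrix a ∅ = 1 := by
    ext i j
    simp [principalMatrix, Matrix.one_apply, Pi.single_apply, eq_comm]
  rw [principalDet, this, Matrix.det_one]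

theorem principalDet_univ (a : Matrix V V R) : principalDet a Finset.univ = (1 - a).det := by
  have : principalMatrix a Finset.univ = 1 - a := by
    ext i j
    simp [principalMatrix, Matrix.one_apply, Pi.single_apply, eq_comm]
  rw [principalDet, this]

theorem det_updateRow_eq_sum (M : Matrix V V R) (x : V) (v : V → R) :
    (M.updateRow x v).det = ∑ y, v y * (M.updateRow x (Pi.single y 1)).det := by
  simp_rw [← Matrix.cramer_transpose_apply]
  conv_lhs => rw [pi_eq_sum_univ' v]
  simp [map_sum, Finset.sum_apply]

/-- Subtracting row x, which is e_y, from row y leaves -a_y there; exchanging the two rows then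
takes y out of S. The two signs cancel. -/
theorem det_updateRow_single_of_mem (a : Matrix V V R) {S : Finset V} {x y : V} (hx : x ∉ S)
    (hy : y ∈ S) :
    ((principalMatrix a S).updateRow x (Pi.single y 1)).det =
      ((principalMatrix a (S.erase y)).updateRow x (a y)).det := by
  have hxy : y ≠ x := fun h => hx (h ▸ hy)
  set N := (principalMatrix a S).updateRow x (Pi.single y 1) with hN
  have h1 : N.updateRow y (N y + (-1 : R) • N x) = N.updateRow y ((-1 : R) • a y) := by
    congr 1
    rw [hN, Matrix.updateRow_ne hxy, Matrix.updateRow_self]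
    ext j
    simp only [principalMatrix, Matrix.of_apply, hy, if_true, Pi.add_apply, Pi.sub_apply,
      Pi.smul_apply, smul_eq_mul]
    ring
  have h2 : (N.updateRow y (a y)).submatrix (Equiv.swap x y) id =
      (principalMatrix a (S.erase y)).updateRow x (a y) := by
    ext i j
    by_cases hi : i = x
    · subst hi; simp
    · by_cases hiy : i = y
      · subst hiy; simp [hN, hi, principalMatrix, Matrix.updateRow_ne, hxy.symm]
      · simp [hN, hi, hiy, principalMatrix, Equiv.swap_apply_of_ne_of_ne hi hiy]
  rw [← Matrix.det_updateRow_add_smul_self N hxy (-1), h1, Matrix.det_updateRow_smul, ← h2,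
    Matrix.det_permute, Equiv.Perm.sign_swap hxy.symm]
  simp

/-- The content of row x is followed as a path from z: choosing the entry y either reaches x and
ends the path, or removes y from S and continues from the row a_y. -/
theorem sum_mul_det_updateRow_single (a : Matrix V V R) (S : Finset V) {x : V} (hx : x ∉ S)
    (z : V) :
    ∑ y, a z y * ((principalMatrix a S).updateRow x (Pi.single y 1)).det =
      ∑ l ∈ nodupLists S, chainProd a z (l ++ [x]) * principalDet a (S \ l.toFinset) := by
  induction S using Finset.strongInduction generalizing z with
  | H S ih =>
    have hS : ∀ y, a z y * ((principalMatrix a S).updateRow x (Pi.single y 1)).det =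
        (if y = x then a z x * principalDet a S else 0) +
          if y ∈ S then a z y * ∑ l ∈ nodupLists (S.erase y),
            chainProd a y (l ++ [x]) * principalDet a (S.erase y \ l.toFinset) else 0 := by
      intro y
      by_cases hyx : y = x
      · subst hyx
        have : (principalMatrix a S).updateRow y (Pi.single y 1) = principalMatrix a S := by
          ext i j
          by_cases hi : i = y
          · subst hi; simp [principalMatrix, hx]
          · simp [hi]
        simp [this, hx, principalDet]
      · by_cases hy : y ∈ S
        · rw [det_updateRow_single_of_mem a hx hy, det_updateRow_eq_sum,
            ih _ (Finset.erase_ssubset hy) (fun h => hx (Finset.mem_of_mem_erase h))]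
          simp [hyx, hy]
        -- For y ∉ S other than x, row y is already e_y, so rows x and y coincide.
        · rw [Matrix.det_zero_of_row_eq hyx]
          · simp [hyx, hy]
          · rw [Matrix.updateRow_ne hyx, Matrix.updateRow_self]
            ext j
            simp [principalMatrix, hy, Matrix.of_apply]
    rw [Finset.sum_congr rfl fun y _ => hS y, Finset.sum_add_distrib, sum_nodupLists]
    congr 1
    · simp [chainProd]
    · rw [Finset.sum_ite_mem, Finset.univ_inter]
      refine Finset.sum_congr rfl fun y _ => ?_
      rw [Finset.mul_sum]
      refine Finset.sum_congr rfl fun l _ => ?_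
      have hc : chainProd a z (y :: l ++ [x]) = a z y * chainProd a y (l ++ [x]) := rfl
      rw [hc, mul_assoc, List.toFinset_cons, Finset.sdiff_insert,
        Finset.erase_sdiff_comm]

/-- Expansion of a principal determinant along the cycles through `x`. -/
theorem principalDet_eq_sub (a : Matrix V V R) {S : Finset V} {x : V} (hx : x ∈ S) :
    principalDet a S = principalDet a (S.erase x) - ∑ l ∈ nodupLists (S.erase x),
      chainProd a x (l ++ [x]) * principalDet a (S.erase x \ l.toFinset) := by
  rw [← sum_mul_det_updateRow_single a _ (Finset.notMem_erase x S), ← det_updateRow_eq_sum]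
  -- Row x is e_x - a_x. By multilinearity, e_x gives the minor without x, and a_x the sum over the
  -- paths that return to x.
  have h1 : principalMatrix a S =
      (principalMatrix a (S.erase x)).updateRow x (Pi.single x 1 + (-1 : R) • a x) := by
    ext i j
    by_cases hi : i = x
    · subst hi; simp [principalMatrix, hx, sub_eq_add_neg]
    · simp [principalMatrix, hi]
  have h2 : (principalMatrix a (S.erase x)).updateRow x (Pi.single x 1) =
      principalMatrix a (S.erase x) := by
    ext i j
    by_cases hi : i = x
    · subst hi; simp [principalMatrix]
    · simp [hi]
  rw [principalDet, h1, Matrix.det_updateRow_add, Matrix.det_updateRow_smul, h2, principalDet]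
  ring

end PrincipalDet

end ConnectionGraph

--BEGIN
namespace ConnectionGraph

/-! ### The minors of I - tΠ are real and see only cos θ. -/

section CycleDet

variable {V : Type*} (G : ConnectionGraph V)

theorem zipWith_prod_eq_chainProd {M : Type*} [Monoid M] (f : V → V → M) (z x : V) (l : List V) :
    (List.zipWith f (z :: l) (l ++ [x])).prod = chainProd f z (l ++ [x]) := by
  induction l generalizing z with
  | nil => simp
  | cons y l ih => rw [List.cons_append, List.zipWith_cons_cons, List.prod_cons, ih, chainProd_cons]

theorem listHol_cons (x : V) (l : List V) : G.listHol (x :: l) = chainProd G.φ x (l ++ [x]) := by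
  rw [listHol, List.rotate_cons_succ, List.rotate_zero, zipWith_prod_eq_chainProd]

variable [Fintype V] [DecidableEq V]

variable {G} in
theorem transitionMatrix_apply (hdeg : ∀ x, G.deg x ≠ 0) (x y : V) :
    G.transitionMatrix x y = (G.p x y : ℂ) * (G.φ x y : ℂ) := by
  have hinv : (G.degMatrix)⁻¹ = Matrix.diagonal fun x => (G.deg x : ℂ)⁻¹ := by
    refine Matrix.inv_eq_left_inv ?_
    rw [degMatrix, Matrix.diagonal_mul_diagonal, ← Matrix.diagonal_one]
    congr 1
    ext x
    exact inv_mul_cancel₀ (by exact_mod_cast hdeg x)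
  rw [transitionMatrix, hinv, Matrix.diagonal_mul, Matrix.hadamard_apply]
  by_cases h : G.graph.Adj x y
  · simp [wMatrix, phaseMatrix, h, p]; ring
  · simp [wMatrix, phaseMatrix, h, p, G.w_zero x y h]

-- Reversing a cycle keeps its nodes, hence the product of the degrees; the edge weights are
-- symmetric, and the phases are inverted, that is, conjugated.
variable {G} in
theorem chainProd_transitionMatrix_reverse (hdeg : ∀ x, G.deg x ≠ 0) (x : V) (l : List V) :
    chainProd G.transitionMatrix x (l.reverse ++ [x]) =
      starRingEnd ℂ (chainProd G.transitionMatrix x (l ++ [x])) := by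
  have hP : (G.transitionMatrix : V → V → ℂ) =
      fun u v => (G.deg u : ℂ)⁻¹ * ((G.w u v : ℂ) * (G.φ u v : ℂ)) := by
    ext u v
    rw [transitionMatrix_apply hdeg, p]
    push_cast
    ring
  have hb : (fun u v => (G.w v u : ℂ) * (G.φ v u : ℂ)) =
      fun u v => starRingEnd ℂ ((G.w u v : ℂ) * (G.φ u v : ℂ)) := by
    ext u v
    by_cases h : G.graph.Adj u v
    · rw [G.φ_inv u v h, G.w_symm v u, Circle.coe_inv_eq_conj, map_mul, Complex.conj_ofReal]
    · simp [G.w_zero u v h, G.w_symm v u]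
  rw [hP, chainProd_mul, chainProd_mul _ _ x (l ++ [x]), chainProd_left, chainProd_left, map_mul,
    chainProd_reverse, hb]
  congr 1
  · simp [map_mul, map_list_prod, Function.comp_def]
  · exact (map_chainProd (starRingEnd ℂ : ℂ →* ℂ) _ x (l ++ [x])).symm

/-- The weight `t ^ k p_{xx₁} ⋯ p_{x_{k-1}x} cos θ` of the cycle `(x, x₁, …, x_{k-1}, x)`. -/
def cycleWeight (t : ℝ) (x : V) (l : List V) : ℝ :=
  t ^ (l.length + 1) * chainProd G.p x (l ++ [x]) * (G.listHol (x :: l) : ℂ).re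

variable {G} in
theorem chainProd_smul_transitionMatrix_re (hdeg : ∀ x, G.deg x ≠ 0) (t : ℝ) (x : V) (l : List V) :
    (chainProd ((t : ℂ) • G.transitionMatrix : Matrix V V ℂ) x (l ++ [x])).re =
      G.cycleWeight t x l := by
  have hP : (((t : ℂ) • G.transitionMatrix : Matrix V V ℂ) : V → V → ℂ) =
      fun u v => (fun _ _ => (t : ℂ)) u v *
        ((fun u v => (G.p u v : ℂ)) u v * (fun u v => (G.φ u v : ℂ)) u v) := by
    ext u v
    simp [transitionMatrix_apply hdeg]
  have h1 := map_chainProd (Complex.ofRealHom : ℝ →* ℂ) G.p x (l ++ [x])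
  have h2 : ((chainProd G.φ x (l ++ [x]) : Circle) : ℂ) =
      chainProd (fun u v => (G.φ u v : ℂ)) x (l ++ [x]) :=
    map_chainProd Circle.coeHom G.φ x (l ++ [x])
  simp only [MonoidHom.coe_coe, Complex.ofRealHom_eq_coe] at h1
  rw [hP, chainProd_mul, chainProd_mul, chainProd_const, ← h1, ← h2, ← listHol_cons, cycleWeight,
    List.length_append, List.length_singleton, ← mul_assoc, ← Complex.ofReal_pow,
    ← Complex.ofReal_mul, Complex.re_ofReal_mul]

-- Reversal is an involution of the cycles through x that preserves the node set, hence the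
-- complementary minor. Averaging each weight with that of the reversed cycle leaves its real part.
variable {G} in
theorem principalDet_transitionMatrix (hdeg : ∀ x, G.deg x ≠ 0) (t : ℝ) {S : Finset V} {x : V}
    (hx : x ∈ S) :
    principalDet ((t : ℂ) • G.transitionMatrix) S =
      principalDet ((t : ℂ) • G.transitionMatrix) (S.erase x) -
        ∑ l ∈ nodupLists (S.erase x), (G.cycleWeight t x l : ℂ) *
          principalDet ((t : ℂ) • G.transitionMatrix) (S.erase x \ l.toFinset) := by
  rw [principalDet_eq_sub _ hx]
  congr 1
  set a := (t : ℂ) • G.transitionMatrix with ha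
  have hrev : ∀ l : List V, chainProd a x (l.reverse ++ [x]) =
      starRingEnd ℂ (chainProd a x (l ++ [x])) := by
    intro l
    have : ∀ l, chainProd a x l = (t : ℂ) ^ l.length * chainProd G.transitionMatrix x l := by
      intro l
      rw [← chainProd_const _ x]
      exact chainProd_mul (fun _ _ => (t : ℂ)) (fun u v => G.transitionMatrix u v) x l
    rw [this, this, chainProd_transitionMatrix_reverse hdeg]
    simp
  have hsum : ∑ l ∈ nodupLists (S.erase x),
      chainProd a x (l ++ [x]) * principalDet a (S.erase x \ l.toFinset) =
      ∑ l ∈ nodupLists (S.erase x), starRingEnd ℂ (chainProd a x (l ++ [x])) *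
        principalDet a (S.erase x \ l.toFinset) := by
    refine Finset.sum_nbij' List.reverse List.reverse ?_ ?_ (by simp) (by simp) ?_
    · intro l; simp [mem_nodupLists]
    · intro l; simp [mem_nodupLists]
    · intro l _; rw [hrev]; simp
  have h2 : (2 : ℂ) ≠ 0 := two_ne_zero
  apply mul_left_cancel₀ h2
  rw [two_mul]
  nth_rw 2 [hsum]
  rw [← Finset.sum_add_distrib, Finset.mul_sum]
  refine Finset.sum_congr rfl fun l _ => ?_
  rw [← add_mul, Complex.add_conj, chainProd_smul_transitionMatrix_re hdeg]
  push_cast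
  ring

/-- The real number `det (1 - t Π)_S`. -/
def cycleDet (t : ℝ) (S : Finset V) : ℝ :=
  (principalDet ((t : ℂ) • G.transitionMatrix) S).re

variable {G} in
theorem cycleDet_eq_sub (hdeg : ∀ x, G.deg x ≠ 0) (t : ℝ) {S : Finset V} {x : V} (hx : x ∈ S) :
    G.cycleDet t S = G.cycleDet t (S.erase x) - ∑ l ∈ nodupLists (S.erase x),
      G.cycleWeight t x l * G.cycleDet t (S.erase x \ l.toFinset) := by
  rw [cycleDet, principalDet_transitionMatrix hdeg t hx]
  simp [cycleDet]

theorem cycleDet_empty (t : ℝ) : G.cycleDet t ∅ = 1 := by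
  simp [cycleDet, principalDet_empty]

-- The recursion has real coefficients, so the minors are real by induction on S.
variable {G} in
theorem ofReal_cycleDet (hdeg : ∀ x, G.deg x ≠ 0) (t : ℝ) (S : Finset V) :
    (G.cycleDet t S : ℂ) = principalDet ((t : ℂ) • G.transitionMatrix) S := by
  induction S using Finset.strongInduction with
  | H S ih =>
    rcases S.eq_empty_or_nonempty with rfl | ⟨x, hx⟩
    · simp [cycleDet_empty, principalDet_empty]
    · rw [cycleDet_eq_sub hdeg t hx, principalDet_transitionMatrix hdeg t hx]
      push_cast
      rw [ih _ (Finset.erase_ssubset hx)]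
      congr 1
      refine Finset.sum_congr rfl fun l _ => ?_
      rw [ih _ (Finset.sdiff_subset.trans_ssubset (Finset.erase_ssubset hx))]

end CycleDet

end ConnectionGraph

--BEGIN
namespace ConnectionGraph

/-! ### Transient substochastic matrices and their Green functions. -/

section SubstochasticMatrix

open Filter Topology

variable {σ : Type*} [Fintype σ]

/-- A substochastic matrix such that the mass decreases from every closed set of states. -/
structure IsTransient (Q : Matrix σ σ ℝ) : Prop where
  nonneg : ∀ s s', 0 ≤ Q s s'
  row_le : ∀ s, ∑ s', Q s s' ≤ 1
  no_trap : ∀ C : Set σ, C.Nonempty → (∀ s ∈ C, ∑ s', Q s s' = 1) →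
    (∀ s ∈ C, ∀ s', 0 < Q s s' → s' ∈ C) → False

namespace IsTransient

variable {Q : Matrix σ σ ℝ} (hQ : IsTransient Q)
include hQ

/-- Maximum principle: if the maximum were positive, the states attaining it would have row sum 1
and lead only to one another, so they would form a trap. -/
theorem eq_zero_of_le {g : σ → ℝ} (h0 : ∀ s, 0 ≤ g s) (h : ∀ s, g s ≤ (Q *ᵥ g) s) (s : σ) :
    g s = 0 := by
  by_contra hs
  have : Nonempty σ := ⟨s⟩
  obtain ⟨m, hm⟩ := Finite.exists_max g
  have hM : 0 < g m := ((h0 s).lt_of_ne' hs).trans_le (hm s)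
  have key : ∀ a, g a = g m → ∀ b, Q a b * (g m - g b) ≤ 0 ∧ 1 ≤ ∑ s', Q a s' := by
    intro a ha b
    have h1 := h a
    simp only [Matrix.mulVec, dotProduct] at h1
    have h3 : ∑ s', Q a s' * (g m - g s') = g m * ∑ s', Q a s' - ∑ s', Q a s' * g s' := by
      rw [Finset.mul_sum, ← Finset.sum_sub_distrib]
      exact Finset.sum_congr rfl fun _ _ => by ring
    have h4 : Q a b * (g m - g b) ≤ ∑ s', Q a s' * (g m - g s') :=
      Finset.single_le_sum (f := fun s' => Q a s' * (g m - g s'))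
        (fun i _ => mul_nonneg (hQ.nonneg _ _) (sub_nonneg.2 (hm i))) (Finset.mem_univ b)
    have h5 : 0 ≤ ∑ s', Q a s' * (g m - g s') :=
      Finset.sum_nonneg fun i _ => mul_nonneg (hQ.nonneg _ _) (sub_nonneg.2 (hm i))
    have h6 := hQ.row_le a
    constructor
    · nlinarith
    · by_contra hlt
      nlinarith
  refine hQ.no_trap {a | g a = g m} ⟨m, rfl⟩
    (fun a ha => le_antisymm (hQ.row_le a) (key a ha a).2) fun a ha b hb => ?_
  have := (key a ha b).1
  have h7 := hm b
  exact le_antisymm h7 (by nlinarith)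

theorem abs_vecMul_le {f : σ → ℝ} {t : ℝ} (ht : |t| ≤ 1) (s : σ) :
    |t * (Q *ᵥ f) s| ≤ (Q *ᵥ fun s => |f s|) s := by
  rw [abs_mul]
  calc |t| * |(Q *ᵥ f) s| ≤ 1 * |(Q *ᵥ f) s| := by gcongr
    _ ≤ _ := by
      rw [one_mul]
      refine (Finset.abs_sum_le_sum_abs _ _).trans (le_of_eq ?_)
      refine Finset.sum_congr rfl fun b _ => ?_
      rw [abs_mul, abs_of_nonneg (hQ.nonneg s b)]

theorem isUnit_det [DecidableEq σ] {t : ℝ} (ht : |t| ≤ 1) : IsUnit (1 - t • Q).det := by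
  rw [isUnit_iff_ne_zero]
  intro hdet
  obtain ⟨f, hf0, hf⟩ := Matrix.exists_mulVec_eq_zero_iff.2 hdet
  apply hf0
  rw [Matrix.sub_mulVec, Matrix.one_mulVec, Matrix.smul_mulVec, sub_eq_zero] at hf
  have := hQ.eq_zero_of_le (g := fun s => |f s|) (fun s => abs_nonneg _) fun s => by
    conv_lhs => rw [hf]
    exact hQ.abs_vecMul_le ht s
  ext s
  simpa using this s

/-- The survival probabilities Q^n 1 decrease to a nonnegative fixed point of Q, which vanishes by
the maximum principle. -/
theorem tendsto_pow_mulVec_one [DecidableEq σ] (s : σ) :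
    Tendsto (fun n : ℕ => ((Q ^ n) *ᵥ 1) s) atTop (𝓝 0) := by
  have hsucc : ∀ n, (Q ^ (n + 1)) *ᵥ 1 = Q *ᵥ ((Q ^ n) *ᵥ 1) := fun n => by
    rw [pow_succ', Matrix.mulVec_mulVec]
  have hmono : ∀ f g : σ → ℝ, (∀ s, f s ≤ g s) → ∀ s, (Q *ᵥ f) s ≤ (Q *ᵥ g) s := fun f g h s =>
    Finset.sum_le_sum fun b _ => mul_le_mul_of_nonneg_left (h b) (hQ.nonneg _ _)
  have h0 : ∀ n s, 0 ≤ ((Q ^ n) *ᵥ 1) s := by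
    intro n
    induction n with
    | zero => simp
    | succ n ih =>
      intro s
      rw [hsucc]
      exact Finset.sum_nonneg fun b _ => mul_nonneg (hQ.nonneg _ _) (ih b)
  have hanti : ∀ n s, ((Q ^ (n + 1)) *ᵥ 1) s ≤ ((Q ^ n) *ᵥ 1) s := by
    intro n
    induction n with
    | zero =>
      intro s
      rw [hsucc, pow_zero, Matrix.one_mulVec]
      simpa only [Matrix.mulVec, dotProduct, Pi.one_apply, mul_one] using hQ.row_le s
    | succ n ih =>
      intro s
      have := hmono _ _ ih s
      rwa [← hsucc, ← hsucc] at this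
  have hlim : ∀ s, ∃ a, Tendsto (fun n : ℕ => ((Q ^ n) *ᵥ 1) s) atTop (𝓝 a) := fun s =>
    ⟨_, tendsto_atTop_ciInf (antitone_nat_of_succ_le fun n => hanti n s)
      ⟨0, by rintro _ ⟨n, rfl⟩; exact h0 n s⟩⟩
  choose a ha using hlim
  have hfix : ∀ s, a s = (Q *ᵥ a) s := by
    intro s
    refine tendsto_nhds_unique ((tendsto_add_atTop_iff_nat 1).2 (ha s)) ?_
    simp only [hsucc]
    exact tendsto_finsetSum _ fun b _ => (ha b).const_mul _
  have := hQ.eq_zero_of_le (g := a) (fun s => ge_of_tendsto' (ha s) fun n => h0 n s)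
    (fun s => (hfix s).le) s
  exact this ▸ ha s

variable {u : ℕ → σ → ℝ} (hu0 : ∀ s, 0 ≤ u 0 s) (hu : ∀ n, u (n + 1) = u n ᵥ* Q)
include hu

include hu0 in
theorem iterate_nonneg (n : ℕ) (s : σ) : 0 ≤ u n s := by
  induction n generalizing s with
  | zero => exact hu0 s
  | succ n ih =>
    rw [hu]
    exact Finset.sum_nonneg fun b _ => mul_nonneg (ih b) (hQ.nonneg _ _)

theorem tendsto_sum_iterate : Tendsto (fun n => ∑ s, u n s) atTop (𝓝 0) := by
  classical
  have h : ∀ n, u n = u 0 ᵥ* Q ^ n := by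
    intro n
    induction n with
    | zero => simp
    | succ n ih => rw [hu, ih, Matrix.vecMul_vecMul, pow_succ]
  have h2 : ∀ n, ∑ s, u n s = ∑ s, u 0 s * ((Q ^ n) *ᵥ 1) s := by
    intro n
    have := Matrix.dotProduct_mulVec (u 0) (Q ^ n) 1
    rw [← h, dotProduct_one] at this
    exact this.symm
  simp only [h2]
  have := tendsto_finsetSum Finset.univ (f := fun s (n : ℕ) => u 0 s * ((Q ^ n) *ᵥ 1) s)
    (a := fun s => u 0 s * 0) (x := atTop)
    fun s _ => (hQ.tendsto_pow_mulVec_one s).const_mul (u 0 s)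
  simpa using this

-- Multiplied by 1 - tQ, the partial sums telescope to u_0 - t^N u_N, and the remainder tends to 0
-- even when |t| = 1. Nonnegativity gives summability at t = 1, which dominates every other t.
include hu0 in
theorem hasSum_iterate [DecidableEq σ] {t : ℝ} (ht : |t| ≤ 1) {U : σ → ℝ}
    (hU : U ᵥ* (1 - t • Q) = u 0) (s : σ) : HasSum (fun n => t ^ n * u n s) (U s) := by
  have hnn := hQ.iterate_nonneg hu0 hu
  have hzero : ∀ s, Tendsto (fun n => u n s) atTop (𝓝 0) := fun s =>
    squeeze_zero (fun n => hnn n s)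
      (fun n => Finset.single_le_sum (f := u n) (fun i _ => hnn n i) (Finset.mem_univ s))
      (hQ.tendsto_sum_iterate hu)
  have hlim : ∀ {t : ℝ}, |t| ≤ 1 → ∀ {U : σ → ℝ}, U ᵥ* (1 - t • Q) = u 0 → ∀ s,
      Tendsto (fun N => ∑ n ∈ Finset.range N, t ^ n * u n s) atTop (𝓝 (U s)) := by
    intro t ht U hU s
    have hinv := hQ.isUnit_det ht
    have hpart : ∀ N, (fun s => ∑ n ∈ Finset.range N, t ^ n * u n s) =
        U - (t ^ N • u N) ᵥ* (1 - t • Q)⁻¹ := by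
      intro N
      have h1 : (fun s => ∑ n ∈ Finset.range N, t ^ n * u n s) ᵥ* (1 - t • Q) =
          u 0 - t ^ N • u N := by
        have : (fun s => ∑ n ∈ Finset.range N, t ^ n * u n s) =
            ∑ n ∈ Finset.range N, t ^ n • u n := by
          ext s; simp
        rw [this, Matrix.sum_vecMul]
        have h3 : ∀ n, (t ^ n • u n) ᵥ* (1 - t • Q) = t ^ n • u n - t ^ (n + 1) • u (n + 1) := by
          intro n
          rw [Matrix.vecMul_sub, Matrix.vecMul_one, Matrix.vecMul_smul, Matrix.smul_vecMul, hu,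
            smul_smul, pow_succ']
        rw [Finset.sum_congr rfl fun n _ => h3 n, Finset.sum_range_sub']
        simp
      have h2 := congrArg (· ᵥ* (1 - t • Q)⁻¹) h1
      simp only [Matrix.vecMul_vecMul, Matrix.mul_nonsing_inv _ hinv, Matrix.vecMul_one] at h2
      rw [h2, Matrix.sub_vecMul, ← hU, Matrix.vecMul_vecMul, Matrix.mul_nonsing_inv _ hinv,
        Matrix.vecMul_one]
    have h4 : ∀ b, Tendsto (fun N => t ^ N * u N b) atTop (𝓝 0) := fun b => by
      refine squeeze_zero_norm (fun N => ?_) (hzero b)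
      rw [Real.norm_eq_abs, abs_mul, abs_pow, abs_of_nonneg (hnn N b)]
      exact mul_le_of_le_one_left (hnn N b) (pow_le_one₀ (abs_nonneg t) ht)
    have h5 : Tendsto (fun N => U s - ∑ b, (t ^ N * u N b) * (1 - t • Q)⁻¹ b s) atTop
        (𝓝 (U s - ∑ b, 0 * (1 - t • Q)⁻¹ b s)) :=
      tendsto_const_nhds.sub (tendsto_finsetSum _ fun b _ => (h4 b).mul_const _)
    simp only [zero_mul, Finset.sum_const_zero, sub_zero] at h5
    refine h5.congr fun N => ?_
    have := congrFun (hpart N) s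
    simp only [this, Pi.sub_apply, Matrix.vecMul, dotProduct, Pi.smul_apply, smul_eq_mul]
  have h1 : |(1 : ℝ)| ≤ 1 := by simp
  have hsum : Summable fun n => u n s := by
    refine ((hasSum_iff_tendsto_nat_of_nonneg (fun n => hnn n s)
      ((u 0 ᵥ* (1 - (1 : ℝ) • Q)⁻¹) s)).2 ?_).summable
    have := hlim h1 (U := u 0 ᵥ* (1 - (1 : ℝ) • Q)⁻¹) (by
      rw [Matrix.vecMul_vecMul, Matrix.nonsing_inv_mul _ (hQ.isUnit_det h1), Matrix.vecMul_one]) s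
    simpa using this
  have hsum' : Summable fun n => t ^ n * u n s := by
    refine hsum.of_norm_bounded fun n => ?_
    rw [Real.norm_eq_abs, abs_mul, abs_pow, abs_of_nonneg (hnn n s)]
    exact mul_le_of_le_one_left (hnn n s) (pow_le_one₀ (abs_nonneg t) ht)
  have := hsum'.hasSum
  rwa [tendsto_nhds_unique this.tendsto_sum_nat (hlim ht hU s)] at this

end IsTransient

end SubstochasticMatrix

end ConnectionGraph

--BEGIN
namespace ConnectionGraph

/-! ### The Markov chain of loop-erased paths is transient. -/

section PathChain

variable {V : Type*} [DecidableEq V]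

/-- The self-avoiding path obtained from `γ` by a step to `z` and the erasure of the loop. -/
def stepPath (γ : List V) (z : V) : List V := γ.takeWhile (fun v => v ≠ z) ++ [z]

theorem takeWhile_ne_append {γ : List V} {z : V} (h : z ∉ γ) (l : List V) :
    (γ ++ z :: l).takeWhile (fun v => v ≠ z) = γ := by
  induction γ with
  | nil => simp
  | cons y γ ih =>
    simp only [List.mem_cons, not_or] at h
    simp only [List.cons_append, List.takeWhile_cons, Ne.symm h.1, ne_eq, not_false_eq_true,
      decide_true, if_true]
    exact congrArg _ (ih h.2)

theorem dropWhile_ne_append {γ : List V} {z : V} (h : z ∉ γ) (l : List V) :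
    (γ ++ z :: l).dropWhile (fun v => v ≠ z) = z :: l := by
  induction γ with
  | nil => simp
  | cons y γ ih =>
    simp only [List.mem_cons, not_or] at h
    simp only [List.cons_append, List.dropWhile_cons, Ne.symm h.1, ne_eq, not_false_eq_true,
      decide_true, if_true]
    simpa using ih h.2

theorem takeWhile_ne_of_notMem {γ : List V} {z : V} (h : z ∉ γ) :
    γ.takeWhile (fun v => v ≠ z) = γ := by
  rw [List.takeWhile_eq_self_iff]
  intro v hv
  simpa using fun hvz : v = z => h (hvz ▸ hv)

theorem dropWhile_ne_of_notMem {γ : List V} {z : V} (h : z ∉ γ) :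
    γ.dropWhile (fun v => v ≠ z) = [] := by
  rw [List.dropWhile_eq_nil_iff]
  intro v hv
  simpa using fun hvz : v = z => h (hvz ▸ hv)

theorem exists_eq_append_cons {γ : List V} {z : V} (h : z ∈ γ) :
    ∃ γ₁ γ₂, γ = γ₁ ++ z :: γ₂ ∧ z ∉ γ₁ := by
  induction γ with
  | nil => simp at h
  | cons y γ ih =>
    by_cases hy : z = y
    · exact ⟨[], γ, by simp [hy], by simp⟩
    · obtain ⟨a, b, rfl, hz⟩ := ih (by simpa [hy] using h)
      exact ⟨y :: a, b, rfl, by simp [hy, hz]⟩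

theorem notMem_takeWhile_ne (γ : List V) (z : V) : z ∉ γ.takeWhile (fun v => v ≠ z) := by
  intro h
  simpa using List.mem_takeWhile_imp h

theorem stepPath_eq_append_iff {γ δ : List V} {z v : V} :
    stepPath γ z = δ ++ [v] ↔ z = v ∧ γ.takeWhile (fun u => u ≠ v) = δ := by
  rw [stepPath]
  constructor
  · intro h
    obtain ⟨h1, h2⟩ := List.append_inj' h rfl
    obtain rfl : z = v := by simpa using h2
    exact ⟨rfl, h1⟩
  · rintro ⟨rfl, rfl⟩
    rfl

variable (G : ConnectionGraph V) [Fintype V]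

instance : Finite G.OrientedCycle :=
  Finite.of_injective (β := {c : Cycle V // c.Nodup}) (fun c => ⟨c.1, c.2.1⟩) fun c c' h =>
    Subtype.ext (by simpa using h)

instance : Fintype G.OrientedCycle := Fintype.ofFinite _

theorem stepPath_mem_nodupLists {S : Finset V} {γ : List V} (hγ : γ ∈ nodupLists S) {z : V}
    (hz : z ∈ S) : stepPath γ z ∈ nodupLists S := by
  rw [mem_nodupLists] at hγ ⊢
  refine ⟨?_, ?_⟩
  · rw [stepPath, List.nodup_append]
    refine ⟨hγ.1.sublist (List.takeWhile_sublist _), List.nodup_singleton z, ?_⟩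
    rintro a ha b hb rfl
    rw [List.mem_singleton] at hb
    exact notMem_takeWhile_ne γ z (hb ▸ ha)
  · intro v hv
    rw [stepPath, List.mem_append, List.mem_singleton] at hv
    rcases hv with hv | rfl
    · exact hγ.2 v ((List.takeWhile_sublist _).subset hv)
    · exact hz

theorem OrientedCycle.cos_angle {V : Type*} {G : ConnectionGraph V} (c : G.OrientedCycle) :
    Real.cos c.angle = (c.hol : ℂ).re := by
  rw [OrientedCycle.hol_eq, Complex.exp_re]
  simp

theorem OrientedCycle.hol_eq_one {V : Type*} {G : ConnectionGraph V} {c : G.OrientedCycle}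
    (h : Real.cos c.angle = 1) : c.hol = 1 := by
  rw [OrientedCycle.cos_angle] at h
  have h1 := Circle.normSq_coe c.hol
  rw [Complex.normSq_apply, h] at h1
  ext
  apply Complex.ext
  · simpa using h
  · simpa using h1

/-- The probability of a step from the end of the path `γ` to `z`. -/
def lastP (γ : List V) (z : V) : ℝ := γ.getLast?.elim 0 fun y => G.p y z

open Classical in
/-- The probability that the cycle closed by a step from the end of the path `γ` to `z`, if any, is
not accepted. -/
def keepProb (γ : List V) (z : V) : ℝ :=
  ∏ c : G.OrientedCycle with c.1 = ((γ.dropWhile (fun v => v ≠ z) : List V) : Cycle V),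
    Real.cos c.angle

variable {G}

theorem keepProb_of_closes {γ : List V} {z : V} {c : G.OrientedCycle}
    (hc : c.1 = ((γ.dropWhile (fun v => v ≠ z) : List V) : Cycle V)) :
    G.keepProb γ z = Real.cos c.angle := by
  classical
  rw [keepProb, Finset.prod_eq_single c]
  · intro b hb hbc
    simp only [Finset.mem_filter, Finset.mem_univ, true_and] at hb
    exact absurd (Subtype.ext (hb.trans hc.symm)) hbc
  · intro h
    simp only [Finset.mem_filter, Finset.mem_univ, true_and] at h
    exact absurd hc h

theorem keepProb_of_notMem {γ : List V} {z : V} (h : z ∉ γ) : G.keepProb γ z = 1 := by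
  classical
  rw [keepProb, dropWhile_ne_of_notMem h]
  refine Finset.prod_eq_one fun c hc => ?_
  simp only [Finset.mem_filter, Finset.mem_univ, true_and] at hc
  have := c.2.2.1
  rw [hc] at this
  simp at this

theorem keepProb_nonneg (hweak : ∀ c : G.OrientedCycle, 0 ≤ Real.cos c.angle) (γ : List V)
    (z : V) : 0 ≤ G.keepProb γ z :=
  Finset.prod_nonneg fun _ _ => hweak _

theorem keepProb_le_one (hweak : ∀ c : G.OrientedCycle, 0 ≤ Real.cos c.angle) (γ : List V)
    (z : V) : G.keepProb γ z ≤ 1 :=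
  Finset.prod_le_one (fun _ _ => hweak _) fun _ _ => Real.cos_le_one _

omit [DecidableEq V] [Fintype V] in
theorem w_nonneg (x y : V) : 0 ≤ G.w x y := by
  by_cases h : G.graph.Adj x y
  · exact (G.w_pos x y h).le
  · exact (G.w_zero x y h).ge

omit [DecidableEq V] in
theorem p_nonneg (x y : V) : 0 ≤ G.p x y :=
  div_nonneg (w_nonneg x y) (Finset.sum_nonneg fun z _ => w_nonneg x z)

omit [DecidableEq V] in
theorem p_of_not_adj {x y : V} (h : ¬ G.graph.Adj x y) : G.p x y = 0 := by
  rw [p, G.w_zero x y h, zero_div]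

omit [DecidableEq V] in
theorem p_pos (hdeg : ∀ x, G.deg x ≠ 0) {x y : V} (h : G.graph.Adj x y) : 0 < G.p x y :=
  div_pos (G.w_pos x y h)
    ((Finset.sum_nonneg fun z _ => w_nonneg x z).lt_of_ne' (hdeg x))

omit [DecidableEq V] in
theorem sum_p (hdeg : ∀ x, G.deg x ≠ 0) (x : V) : ∑ y, G.p x y = 1 := by
  simp only [p, ← Finset.sum_div]
  exact div_self (hdeg x)

omit [DecidableEq V] in
theorem lastP_nonneg (γ : List V) (z : V) : 0 ≤ G.lastP γ z := by
  rw [lastP]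
  cases γ.getLast? with
  | none => simp
  | some y => exact p_nonneg y z

omit [DecidableEq V] in
theorem sum_lastP_le (hdeg : ∀ x, G.deg x ≠ 0) (γ : List V) : ∑ z, G.lastP γ z ≤ 1 := by
  simp only [lastP]
  cases γ.getLast? with
  | none => simp
  | some y => exact (sum_p hdeg y).le

variable (G) in
/-- The transition matrix of the loop-erased path, killed when the walk leaves `S` or accepts a
cycle. -/
def pathMatrix (S : Finset V) : Matrix (nodupLists S) (nodupLists S) ℝ :=
  Matrix.of fun γ γ' => ∑ z ∈ S,
    if stepPath γ.1 z = γ'.1 then G.lastP γ.1 z * G.keepProb γ.1 z else 0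

theorem sum_pathMatrix {S : Finset V} (γ : nodupLists S) :
    ∑ γ', G.pathMatrix S γ γ' = ∑ z ∈ S, G.lastP γ.1 z * G.keepProb γ.1 z := by
  simp only [pathMatrix, Matrix.of_apply]
  rw [Finset.sum_comm]
  refine Finset.sum_congr rfl fun z hz => ?_
  rw [Finset.sum_eq_single ⟨stepPath γ.1 z, stepPath_mem_nodupLists γ.2 hz⟩]
  · simp
  · intro b _ hb
    rw [if_neg fun h => hb (Subtype.ext h.symm)]
  · simp

theorem sum_pathMatrix_le (hdeg : ∀ x, G.deg x ≠ 0)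
    (hweak : ∀ c : G.OrientedCycle, 0 ≤ Real.cos c.angle) {S : Finset V} (γ : nodupLists S) :
    ∑ γ', G.pathMatrix S γ γ' ≤ 1 := by
  rw [sum_pathMatrix]
  calc ∑ z ∈ S, G.lastP γ.1 z * G.keepProb γ.1 z ≤ ∑ z ∈ S, G.lastP γ.1 z :=
        Finset.sum_le_sum fun z _ =>
          mul_le_of_le_one_right (lastP_nonneg _ _) (keepProb_le_one hweak _ _)
    _ ≤ ∑ z, G.lastP γ.1 z :=
        Finset.sum_le_sum_of_subset_of_nonneg (Finset.subset_univ S) fun z _ _ => lastP_nonneg _ _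
    _ ≤ 1 := sum_lastP_le hdeg _

theorem pathMatrix_nonneg (hweak : ∀ c : G.OrientedCycle, 0 ≤ Real.cos c.angle) {S : Finset V}
    (γ γ' : nodupLists S) : 0 ≤ G.pathMatrix S γ γ' := by
  refine Finset.sum_nonneg fun z _ => ?_
  split_ifs
  · exact mul_nonneg (lastP_nonneg _ _) (keepProb_nonneg hweak _ _)
  · rfl

/-- A cycle can be based at each of its nodes. -/
theorem OrientedCycle.exists_eq_cons {V : Type*} {G : ConnectionGraph V} (c : G.OrientedCycle)
    {y : V} (hy : y ∈ c.1) : ∃ l : List V, c.1 = ((y :: l : List V) : Cycle V) := by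
  obtain ⟨L, hL⟩ := Quotient.exists_rep c.1
  rw [← hL] at hy ⊢
  obtain ⟨s, t, rfl⟩ := List.append_of_mem (Cycle.mem_coe_iff.1 hy)
  exact ⟨t ++ s, Cycle.coe_eq_coe.2 (by
    rw [← List.cons_append]
    exact List.isRotated_append)⟩

/-- By connectedness, paths of C end at every node. Let c have non-trivial holonomy and let γ be a
shortest path of C ending on c, at y. Following c from y extends γ without meeting it again, so the
return to y closes exactly c. The absence of loss then forces cos θ(c) = 1, hence hol(c) = 1. -/
theorem no_closed_paths (hconn : G.graph.Connected) (hnontriv : ∃ c : G.OrientedCycle, c.hol ≠ 1)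
    {C : Set (List V)} (hne : C.Nonempty) (hnil : [] ∉ C)
    (hstep : ∀ γ ∈ C, ∀ y, γ.getLast? = some y → ∀ z, G.graph.Adj y z →
      G.keepProb γ z = 1 ∧ stepPath γ z ∈ C) : False := by
  have hreach : ∀ v, ∃ γ ∈ C, γ.getLast? = some v := by
    obtain ⟨γ, hγ⟩ := hne
    intro v
    have hγ0 : γ ≠ [] := fun h => hnil (h ▸ hγ)
    have hlast := List.getLast?_eq_some_getLast hγ0
    obtain ⟨W⟩ := hconn.preconnected (γ.getLast hγ0) v
    generalize γ.getLast hγ0 = y at W hlast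
    clear hγ0
    induction W generalizing γ with
    | nil => exact ⟨γ, hγ, hlast⟩
    | cons h W ih =>
      exact ih (stepPath γ _) (hstep γ hγ _ hlast _ h).2 (by simp [stepPath])
  obtain ⟨c, hc⟩ := hnontriv
  have hex : ∃ n : ℕ, ∃ γ ∈ C, γ.length = n ∧ ∃ y ∈ c.1, γ.getLast? = some y := by
    obtain ⟨L, hL⟩ := Quotient.exists_rep c.1
    have hlen := c.2.2.1
    rw [← hL] at hlen
    cases L with
    | nil =>
      have : (Cycle.length (([] : List V) : Cycle V)) = 0 := rfl
      exact absurd (hlen.trans_eq this) (by norm_num)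
    | cons y L =>
      obtain ⟨γ, hγ, hy⟩ := hreach y
      exact ⟨_, γ, hγ, rfl, y, hL ▸ Cycle.mem_coe_iff.2 List.mem_cons_self, hy⟩
  classical
  obtain ⟨γ, hγ, hlen, y, hyc, hlast⟩ := Nat.find_spec hex
  have hmin : ∀ γ' ∈ C, ∀ z ∈ c.1, γ'.getLast? = some z → γ.length ≤ γ'.length :=
    fun γ' hγ' z hz hl => hlen ▸ Nat.find_min' hex ⟨γ', hγ', rfl, z, hz, hl⟩
  obtain ⟨l, hl⟩ := c.exists_eq_cons hyc
  have hnodup : (y :: l).Nodup := by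
    have := c.2.1
    rwa [hl, Cycle.nodup_coe_iff] at this
  have hchain : List.IsChain G.graph.Adj (y :: (l ++ [y])) := by
    have := c.2.2.2
    rwa [hl, Cycle.chain_coe_cons] at this
  have hlast' : ∀ l₁, (γ ++ l₁).getLast? = (y :: l₁).getLast? := by
    intro l₁
    cases l₁ with
    | nil => simpa using hlast
    | cons a l₁ => simp [List.getLast?_append, List.getLast?_cons]
  have hadj : ∀ l₁ z l₂, y :: (l ++ [y]) = y :: (l₁ ++ z :: l₂) → ∀ u,
      (y :: l₁).getLast? = some u → G.graph.Adj u z := by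
    intro l₁ z l₂ h u hu
    rw [h, ← List.cons_append, List.isChain_append] at hchain
    exact hchain.2.2 u hu z (by simp)
  have hall : ∀ l₁ l₂, l = l₁ ++ l₂ → γ ++ l₁ ∈ C := by
    intro l₁
    induction l₁ using List.reverseRecOn with
    | nil => intro l₂ _; simpa using hγ
    | append_singleton l₁ z ih =>
      intro l₂ hl₂
      rw [List.append_assoc, List.singleton_append] at hl₂
      have hC := ih _ hl₂
      have hs : ∃ u, (y :: l₁).getLast? = some u := ⟨_, List.getLast?_eq_some_getLast (by simp)⟩
      obtain ⟨u, hu⟩ := hs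
      have hz := hstep _ hC u ((hlast' l₁).trans hu) z
        (hadj l₁ z (l₂ ++ [y]) (by simp [hl₂]) u hu)
      have hzc : z ∈ c.1 := by rw [hl, Cycle.mem_coe_iff, hl₂]; simp
      have hzy : z ≠ y := by
        rintro rfl
        rw [hl₂] at hnodup
        simp at hnodup
      have hzl : z ∉ l₁ := by
        rw [hl₂, List.nodup_cons, List.nodup_append] at hnodup
        exact fun h => hnodup.2.2.2 z h z (by simp) rfl
      -- A step onto a node z of γ would truncate γ to a path of C ending on c. By minimality
      -- nothing can be removed, so z would be the last node y.
      have hzγ : z ∉ γ := by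
        intro h
        obtain ⟨γ₁, γ₂, rfl, hz1⟩ := exists_eq_append_cons h
        have := hmin _ hz.2 z hzc (by simp [stepPath])
        rw [stepPath, List.append_assoc, List.cons_append, takeWhile_ne_append hz1] at this
        simp only [List.length_append, List.length_cons, List.length_nil] at this
        have h0 : γ₂ = [] := List.length_eq_zero_iff.1 (by omega)
        subst h0
        simp at hlast
        exact hzy hlast
      have := hz.2
      rwa [stepPath, takeWhile_ne_of_notMem (by simp [hzγ, hzl]), List.append_assoc] at this
  have hC := hall l [] (by simp)
  obtain ⟨u, hu⟩ : ∃ u, (y :: l).getLast? = some u :=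
    ⟨_, List.getLast?_eq_some_getLast (by simp)⟩
  have hk := (hstep _ hC u ((hlast' l).trans hu) y (hadj l y [] rfl u hu)).1
  obtain ⟨γ₁, γ₂, hγ12, hy1⟩ := exists_eq_append_cons (List.mem_of_getLast? hlast)
  -- Minimality again: an earlier occurrence of y in γ would give a shorter path of C ending at y.
  -- Hence the erased loop is c, with nothing of γ before y.
  have hγ2 : γ₂ = [] := by
    by_contra h0
    have hS : stepPath (γ ++ l) y ∈ C :=
      (hstep _ hC u ((hlast' l).trans hu) y (hadj l y [] rfl u hu)).2
    have := hmin _ hS y hyc (by simp [stepPath])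
    rw [stepPath, hγ12, List.append_assoc, List.cons_append, takeWhile_ne_append hy1] at this
    simp only [List.length_append, List.length_cons, List.length_nil] at this
    exact h0 (List.length_eq_zero_iff.1 (by omega))
  rw [keepProb_of_closes (c := c)] at hk
  · exact hc (OrientedCycle.hol_eq_one hk)
  · rw [hl, hγ12, hγ2, List.append_assoc, List.singleton_append, dropWhile_ne_append hy1]

theorem isTransient_pathMatrix (hconn : G.graph.Connected)
    (hnontriv : ∃ c : G.OrientedCycle, c.hol ≠ 1) (hdeg : ∀ x, G.deg x ≠ 0)
    (hweak : ∀ c : G.OrientedCycle, 0 ≤ Real.cos c.angle) (S : Finset V) :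
    IsTransient (G.pathMatrix S) where
  nonneg := pathMatrix_nonneg hweak
  row_le := sum_pathMatrix_le hdeg hweak
  no_trap := by
    intro C hne hrow hclosed
    refine no_closed_paths hconn hnontriv (C := Subtype.val '' C) (hne.image _) ?_ ?_
    -- The empty path has no last node, so its row is zero and cannot have sum 1.
    · rintro ⟨⟨γ, hγS⟩, hγ, rfl⟩
      have := hrow _ hγ
      rw [sum_pathMatrix] at this
      simp [lastP] at this
    · rintro _ ⟨⟨γ, hγS⟩, hγ, rfl⟩ y hy z hz
      have hr := hrow _ hγ
      rw [sum_pathMatrix] at hr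
      simp only [lastP, hy, Option.elim_some] at hr
      -- The mass lost from γ, a sum of nonnegative terms: if it vanishes, each neighbour of y lies
      -- in S and is reached without any possible acceptance.
      have hzero : ∑ z, G.p y z * (1 - if z ∈ S then G.keepProb γ z else 0) = 0 := by
        simp only [mul_sub, mul_one, Finset.sum_sub_distrib, sum_p hdeg, mul_ite, mul_zero,
          Finset.sum_ite_mem, Finset.univ_inter, hr, sub_self]
      rw [Finset.sum_eq_zero_iff_of_nonneg] at hzero
      · have h1 := hzero z (Finset.mem_univ z)
        rw [mul_eq_zero, or_iff_right (p_pos hdeg hz).ne', sub_eq_zero] at h1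
        have hzS : z ∈ S := by
          by_contra h
          simp [h] at h1
        rw [if_pos hzS] at h1
        refine ⟨h1.symm, ⟨stepPath γ z, stepPath_mem_nodupLists hγS hzS⟩,
          hclosed _ hγ _ ?_, rfl⟩
        refine lt_of_lt_of_le ?_ (Finset.single_le_sum (f := fun z' => if stepPath γ z' =
          stepPath γ z then G.lastP γ z' * G.keepProb γ z' else 0) (fun i _ => ?_) hzS)
        · simp [lastP, hy, ← h1, p_pos hdeg hz]
        · split_ifs
          · exact mul_nonneg (lastP_nonneg _ _) (keepProb_nonneg hweak _ _)
          · rfl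
      · intro v _
        refine mul_nonneg (p_nonneg _ _) ?_
        split_ifs
        · exact sub_nonneg.2 (keepProb_le_one hweak _ _)
        · simp

end PathChain

end ConnectionGraph

--BEGIN
namespace ConnectionGraph

/-! ### Explicit Green function and non-vanishing of the minors. -/

section GreenFunction

variable {V : Type*} [DecidableEq V] [Fintype V] (G : ConnectionGraph V)

/-- The weight `t ^ m p_{xx₁} ⋯ p_{x_{m-1}x_m}` of the path `γ`, if it starts at `x`. -/
def pathWeight (t : ℝ) (x : V) : List V → ℝ
  | [] => 0
  | y :: l => if y = x then chainProd (fun u v => t * G.p u v) x l else 0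

variable {G}

theorem pathWeight_append (t : ℝ) (x v : V) (δ l : List V) :
    G.pathWeight t x (δ ++ v :: l) =
      G.pathWeight t x (δ ++ [v]) * chainProd (fun u v => t * G.p u v) v l := by
  cases δ with
  | nil =>
    by_cases h : v = x
    · subst h; simp [pathWeight]
    · simp [pathWeight, h]
  | cons y δ =>
    by_cases h : y = x
    · simp [pathWeight, h, chainProd_append _ x v δ l]
    · simp [pathWeight, h]

theorem pathWeight_concat (t : ℝ) (x v : V) {δ : List V} (hδ : δ ≠ []) :
    G.pathWeight t x (δ ++ [v]) = t * (G.pathWeight t x δ * G.lastP δ v) := by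
  cases δ with
  | nil => exact absurd rfl hδ
  | cons y δ =>
    by_cases h : y = x
    · subst h
      have hl := List.getLast?_eq_some_getLast hδ
      simp only [pathWeight, if_true, List.cons_append, lastP, hl, Option.elim_some,
        chainProd_concat _ hl]
      ring
    · simp [pathWeight, h]

omit [DecidableEq V] in
theorem isChain_of_chainProd_ne_zero {z : V} {l : List V} (h : chainProd G.p z l ≠ 0) :
    List.IsChain G.graph.Adj (z :: l) := by
  induction l generalizing z with
  | nil => simp
  | cons y l ih =>
    rw [chainProd_cons] at h
    rw [List.isChain_cons_cons]
    exact ⟨by_contra fun hzy => left_ne_zero_of_mul h (p_of_not_adj hzy),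
      ih (right_ne_zero_of_mul h)⟩

/-- The common factor is needed: if the loop is not a cycle of the graph, `keepProb` is an empty
product and need not equal the cosine, but the product of the transition probabilities is then zero.
-/
theorem chainProd_mul_keepProb {δ l : List V} {v : V} (hv : v ∉ δ) (hl : (v :: l).Nodup) :
    chainProd G.p v (l ++ [v]) * G.keepProb (δ ++ v :: l) v =
      chainProd G.p v (l ++ [v]) * (G.listHol (v :: l) : ℂ).re := by
  by_cases h : chainProd G.p v (l ++ [v]) = 0
  · rw [h, zero_mul, zero_mul]
  have hch := isChain_of_chainProd_ne_zero h
  have hlen : 2 ≤ (v :: l).length := by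
    cases l with
    | nil => simp at hch
    | cons a l => simp
  let c : G.OrientedCycle := ⟨((v :: l : List V) : Cycle V), Cycle.nodup_coe_iff.2 hl,
    hlen, (Cycle.chain_coe_cons _ _ _).2 hch⟩
  rw [keepProb_of_closes (c := c) (by rw [dropWhile_ne_append hv]), OrientedCycle.cos_angle]
  rfl

omit [DecidableEq V] in
theorem chainProd_mul_left (t : ℝ) (z : V) (l : List V) :
    chainProd (fun u v => t * G.p u v) z l = t ^ l.length * chainProd G.p z l := by
  rw [← chainProd_const t z l, ← chainProd_mul]

/-- A step to v produces δ ++ [v] in two ways: v extends δ, or a loop l based at v is erased. -/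
theorem nodupLists_filter_takeWhile {S : Finset V} {δ : List V} {v : V}
    (h : δ ++ [v] ∈ nodupLists S) :
    (nodupLists S).filter (fun γ => γ.takeWhile (fun u => u ≠ v) = δ) =
      insert δ ((nodupLists ((S \ δ.toFinset).erase v)).image fun l => δ ++ v :: l) := by
  rw [mem_nodupLists, List.nodup_append] at h
  obtain ⟨⟨h1, -, h2⟩, h3⟩ := h
  have hv : v ∉ δ := fun hv => h2 v hv v (by simp) rfl
  ext γ
  simp only [Finset.mem_filter, Finset.mem_insert, Finset.mem_image]
  constructor
  · rintro ⟨hγ, hγδ⟩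
    rw [mem_nodupLists] at hγ
    by_cases hvγ : v ∈ γ
    · obtain ⟨γ₁, l, rfl, hv1⟩ := exists_eq_append_cons hvγ
      rw [takeWhile_ne_append hv1] at hγδ
      subst hγδ
      refine Or.inr ⟨l, ?_, rfl⟩
      rw [List.nodup_append, List.nodup_cons] at hγ
      rw [mem_nodupLists]
      refine ⟨hγ.1.2.1.2, fun u hu => ?_⟩
      simp only [Finset.mem_erase, Finset.mem_sdiff, List.mem_toFinset]
      refine ⟨fun huv => hγ.1.2.1.1 (huv ▸ hu), hγ.2 u (by simp [hu]), fun hu' => ?_⟩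
      exact hγ.1.2.2 u hu' u (by simp [hu]) rfl
    · rw [takeWhile_ne_of_notMem hvγ] at hγδ
      exact Or.inl hγδ
  · rintro (rfl | ⟨l, hl, rfl⟩)
    · exact ⟨mem_nodupLists.2 ⟨h1, fun u hu => h3 u (by simp [hu])⟩, takeWhile_ne_of_notMem hv⟩
    · refine ⟨?_, takeWhile_ne_append hv l⟩
      rw [mem_nodupLists] at hl ⊢
      simp only [Finset.mem_erase, Finset.mem_sdiff, List.mem_toFinset] at hl
      refine ⟨?_, ?_⟩
      · rw [List.nodup_append, List.nodup_cons]
        refine ⟨h1, ⟨fun hvl => (hl.2 v hvl).1 rfl, hl.1⟩, ?_⟩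
        rintro a ha b hb rfl
        rcases List.mem_cons.1 hb with rfl | hb
        · exact hv ha
        · exact (hl.2 a hb).2.2 ha
      · intro u hu
        rcases List.mem_append.1 hu with hu | hu
        · exact h3 u (by simp [hu])
        · rcases List.mem_cons.1 hu with rfl | hu
          · exact h3 u (by simp)
          · exact (hl.2 u hu).2.1

/-- The equation satisfied by the Green function of the loop-erased path. -/
theorem vecMul_one_sub_pathMatrix (hdeg : ∀ x, G.deg x ≠ 0) (t : ℝ) (S : Finset V) (x : V) :
    (fun γ : nodupLists S => G.pathWeight t x γ.1 * G.cycleDet t (S \ γ.1.toFinset)) ᵥ*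
      (1 - t • G.pathMatrix S) = fun γ => if γ.1 = [x] then G.cycleDet t S else 0 := by
  ext ⟨γ', hγ'⟩
  rw [Matrix.vecMul_sub, Matrix.vecMul_one, Matrix.vecMul_smul, Pi.sub_apply, Pi.smul_apply,
    smul_eq_mul]
  simp only [Matrix.vecMul, dotProduct, pathMatrix, Matrix.of_apply]
  rcases List.eq_nil_or_concat' γ' with rfl | ⟨δ, v, rfl⟩
  · simp [pathWeight, stepPath]
  have hvS : v ∈ S := (mem_nodupLists.1 hγ').2 v (by simp)
  have hv : v ∉ δ := fun hv => by
    have := (mem_nodupLists.1 hγ').1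
    rw [List.nodup_append] at this
    exact this.2.2 v hv v (by simp) rfl
  have hvSδ : v ∈ S \ δ.toFinset := by simp [hvS, hv]
  have hsum : ∑ γ : nodupLists S, G.pathWeight t x γ.1 * G.cycleDet t (S \ γ.1.toFinset) *
      (∑ z ∈ S, if stepPath γ.1 z = δ ++ [v] then G.lastP γ.1 z * G.keepProb γ.1 z else 0) =
      ∑ γ ∈ (nodupLists S).filter (fun γ => γ.takeWhile (fun u => u ≠ v) = δ),
        G.pathWeight t x γ * G.cycleDet t (S \ γ.toFinset) *
          (G.lastP γ v * G.keepProb γ v) := by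
    rw [Finset.sum_coe_sort (nodupLists S) fun γ => G.pathWeight t x γ *
      G.cycleDet t (S \ γ.toFinset) * (∑ z ∈ S, if stepPath γ z = δ ++ [v] then
        G.lastP γ z * G.keepProb γ z else 0), Finset.sum_filter]
    refine Finset.sum_congr rfl fun γ _ => ?_
    simp only [stepPath_eq_append_iff, ite_and, Finset.sum_ite_eq', hvS, if_true]
    split_ifs <;> simp
  rw [hsum, nodupLists_filter_takeWhile hγ', Finset.sum_insert, Finset.sum_image]
  rotate_left
  · intro l _ l' _ h
    simpa using h
  · simp only [Finset.mem_image, not_exists, not_and]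
    intro l _ h
    have := congrArg List.length h
    simp at this
  -- Going around a loop at v and surviving multiplies the weight of δ ++ [v] by t^k p cos θ; the
  -- factor t of the closing step is the one in front of the matrix.
  have hloop : ∀ l ∈ nodupLists ((S \ δ.toFinset).erase v),
      t * (G.pathWeight t x (δ ++ v :: l) * G.cycleDet t (S \ (δ ++ v :: l).toFinset) *
        (G.lastP (δ ++ v :: l) v * G.keepProb (δ ++ v :: l) v)) =
      G.pathWeight t x (δ ++ [v]) * (G.cycleWeight t v l *
        G.cycleDet t ((S \ δ.toFinset).erase v \ l.toFinset)) := by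
    intro l hl
    have hnd : (v :: l).Nodup := by
      rw [mem_nodupLists] at hl
      exact List.nodup_cons.2 ⟨fun h => by simpa using hl.2 v h, hl.1⟩
    have hS : S \ (δ ++ v :: l).toFinset = (S \ δ.toFinset).erase v \ l.toFinset := by
      ext u
      simp only [Finset.mem_sdiff, List.mem_toFinset, List.mem_append, List.mem_cons,
        Finset.mem_erase]
      tauto
    have hlast : G.lastP (δ ++ v :: l) v = G.lastP (v :: l) v := by
      simp only [lastP, List.getLast?_append_of_ne_nil δ (List.cons_ne_nil v l)]
    have hp : chainProd G.p v (l ++ [v]) = chainProd G.p v l * G.lastP (v :: l) v := by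
      have hl' := List.getLast?_eq_some_getLast (List.cons_ne_nil v l)
      rw [chainProd_concat _ hl', lastP, hl', Option.elim_some]
    have hk := chainProd_mul_keepProb (G := G) (l := l) hv hnd
    rw [hS, hlast, pathWeight_append, cycleWeight, chainProd_mul_left]
    rw [hp] at hk ⊢
    rw [mul_assoc (t ^ (l.length + 1)), ← hk]
    ring
  have hD := cycleDet_eq_sub hdeg t hvSδ
  have hS : S \ (δ ++ [v]).toFinset = (S \ δ.toFinset).erase v := by
    ext u
    simp only [Finset.mem_sdiff, List.mem_toFinset, List.mem_append, List.mem_singleton,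
      Finset.mem_erase]
    tauto
  rw [mul_add, Finset.mul_sum, Finset.sum_congr rfl hloop, ← Finset.mul_sum, hS,
    keepProb_of_notMem hv]
  -- By the cycle expansion at v, the inflow from loops accounts for all but D_t(S∖δ), which the
  -- inflow from δ cancels. For δ = [] there is no such inflow, and the source term at [x] remains.
  have hW : ∑ l ∈ nodupLists ((S \ δ.toFinset).erase v), G.cycleWeight t v l *
      G.cycleDet t ((S \ δ.toFinset).erase v \ l.toFinset) =
      G.cycleDet t ((S \ δ.toFinset).erase v) - G.cycleDet t (S \ δ.toFinset) := by
    rw [hD]; ring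
  rw [hW]
  by_cases hδ : δ = []
  · subst hδ
    by_cases hvx : v = x
    · simp [pathWeight, hvx]
    · simp [pathWeight, hvx]
  · have hne : δ ++ [v] ≠ [x] := fun h => hδ (by simpa using congrArg List.length h)
    rw [pathWeight_concat t x v hδ, if_neg hne]
    ring

/-- If D_t(S) = 0, the source of the Green equation vanishes, hence so does its solution, 1 - tQ
being invertible. But its value at [x] is D_t(S∖x), nonzero by induction. -/
theorem cycleDet_ne_zero (hdeg : ∀ x, G.deg x ≠ 0)
    (hQ : ∀ S, IsTransient (G.pathMatrix S)) {t : ℝ} (ht : |t| ≤ 1) (S : Finset V) :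
    G.cycleDet t S ≠ 0 := by
  induction S using Finset.strongInduction with
  | H S ih =>
    rcases S.eq_empty_or_nonempty with rfl | ⟨x, hx⟩
    · simp [cycleDet_empty]
    · intro h0
      have h := vecMul_one_sub_pathMatrix hdeg t S x
      have h1 := congrArg (· ᵥ* (1 - t • G.pathMatrix S)⁻¹) h
      simp only [h0, ite_self, Matrix.vecMul_vecMul,
        Matrix.mul_nonsing_inv _ ((hQ S).isUnit_det ht), Matrix.vecMul_one] at h1
      have hx' : [x] ∈ nodupLists S := mem_nodupLists.2 ⟨by simp, by simpa using hx⟩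
      have h2 := congrFun h1 ⟨[x], hx'⟩
      have h3 : S \ [x].toFinset = S.erase x := by
        ext u
        simp [and_comm]
      have h4 : ((fun _ => 0 : nodupLists S → ℝ) ᵥ* (1 - t • G.pathMatrix S)⁻¹) ⟨[x], hx'⟩ = 0 := by
        simp [Matrix.vecMul, dotProduct]
      rw [h4] at h2
      simp only [pathWeight, if_true, chainProd_nil, one_mul, h3] at h2
      exact ih _ (Finset.erase_ssubset hx) h2

end GreenFunction

end ConnectionGraph

--BEGIN
namespace ConnectionGraph

theorem measureReal_eq_sum_inter_fiber {Ω β : Type*} [MeasurableSpace Ω] {P : Measure Ω}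
    [IsProbabilityMeasure P] {E : Set Ω} (f : Ω → β) (s : Finset β)
    (hf : ∀ b ∈ s, MeasurableSet (f ⁻¹' {b})) (hE : ∀ᵐ ω ∂P, ω ∈ E → f ω ∈ s) :
    P.real E = ∑ b ∈ s, P.real (E ∩ f ⁻¹' {b}) := by
  have h1 : P E = P (E ∩ f ⁻¹' s) := by
    refine measure_congr ?_
    filter_upwards [hE] with ω hω
    exact propext ⟨fun h => ⟨h, hω h⟩, fun h => h.1⟩
  have hs : MeasurableSet (f ⁻¹' (s : Set β)) := by
    have : f ⁻¹' (s : Set β) = ⋃ b ∈ s, f ⁻¹' {b} := by ext; simp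
    rw [this]
    exact Finset.measurableSet_biUnion _ hf
  have h2 : P E = ∑ b ∈ s, P (E ∩ f ⁻¹' {b}) := by
    rw [h1, Set.inter_comm, ← Measure.restrict_apply hs, ← sum_measure_preimage_singleton s hf]
    refine Finset.sum_congr rfl fun b hb => ?_
    rw [Measure.restrict_apply (hf b hb), Set.inter_comm]
  rw [measureReal_def, h2, ENNReal.toReal_sum fun _ _ => measure_ne_top _ _]
  rfl

section Deterministic

variable {V : Type*} [DecidableEq V]

theorem loopErased_succ (ξ : ℕ → V) (n : ℕ) :
    loopErased ξ (n + 1) = stepPath (loopErased ξ n) (ξ (n + 1)) := rfl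

theorem loopErased_congr {ξ ξ' : ℕ → V} {n : ℕ} (h : ∀ k ≤ n, ξ k = ξ' k) :
    loopErased ξ n = loopErased ξ' n := by
  induction n with
  | zero => simp [loopErased, h 0 le_rfl]
  | succ n ih =>
    rw [loopErased_succ, loopErased_succ, ih fun k hk => h k (by omega), h _ le_rfl]

theorem getLast?_loopErased (ξ : ℕ → V) (n : ℕ) : (loopErased ξ n).getLast? = some (ξ n) := by
  cases n <;> simp [loopErased]

theorem head?_loopErased (ξ : ℕ → V) (n : ℕ) : (loopErased ξ n).head? = some (ξ 0) := by
  induction n with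
  | zero => simp [loopErased]
  | succ n ih =>
    rw [loopErased_succ, stepPath]
    cases h : loopErased ξ n with
    | nil => simp [h] at ih
    | cons y l =>
      rw [h, List.head?_cons, Option.some_inj] at ih
      by_cases hy : y = ξ (n + 1)
      · simp [hy, ← ih]
      · rw [ih] at hy
        simp [hy, ih]

theorem loopErased_mem_nodupLists [Fintype V] {S : Finset V} {ξ : ℕ → V} {n : ℕ}
    (h : ∀ k ≤ n, ξ k ∈ S) : loopErased ξ n ∈ nodupLists S := by
  induction n with
  | zero => simp [loopErased, mem_nodupLists, h 0 le_rfl]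
  | succ n ih =>
    exact stepPath_mem_nodupLists (ih fun k hk => h k (by omega)) (h _ le_rfl)

variable (G : ConnectionGraph V)

theorem closes_congr {ξ ξ' : ℕ → V} {n : ℕ} (h : ∀ k ≤ n, ξ k = ξ' k) (c : G.OrientedCycle) :
    G.Closes ξ c n ↔ G.Closes ξ' c n := by
  cases n with
  | zero => rfl
  | succ n => rw [Closes, Closes, loopErased_congr fun k hk => h k (by omega), h _ le_rfl]

/-- The walk neither hits `A` nor accepts a cycle up to time `n`. -/
def Running (A : Finset V) (ξ : ℕ → V) (b : G.OrientedCycle → ℕ → Bool) (n : ℕ) : Prop :=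
  ∀ k ≤ n, ξ k ∉ A ∧ ∀ c, G.Closes ξ c k → b c k = false

variable {G} {A : Finset V} {ξ : ℕ → V} {b : G.OrientedCycle → ℕ → Bool}

theorem Running.mono {m n : ℕ} (h : G.Running A ξ b n) (hmn : m ≤ n) : G.Running A ξ b m :=
  fun k hk => h k (hk.trans hmn)

theorem lt_stopTime_iff {n : ℕ} : (n : ℕ∞) < G.stopTime A ξ b ↔ G.Running A ξ b n := by
  have h : ∀ a : ℕ∞, (n : ℕ∞) < a ↔ ((n + 1 : ℕ) : ℕ∞) ≤ a := fun a => by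
    rw [Nat.cast_add, Nat.cast_one, ENat.add_one_le_iff (ENat.natCast_ne_top n)]
  rw [h, stopTime, le_inf_iff]
  simp only [hitTime, cycleTime, le_iInf_iff, Nat.cast_le, Running]
  constructor
  · rintro ⟨h1, h2⟩ k hk
    refine ⟨fun hA => ?_, fun c hc => ?_⟩
    · have := h1 k hA
      omega
    · by_contra hb
      have := h2 c k ⟨hc, by simpa using hb⟩
      omega
  · intro h
    refine ⟨fun k hA => ?_, fun c k hck => ?_⟩
    · by_contra hk
      exact (h k (by omega)).1 hA
    · by_contra hk
      have := (h k (by omega)).2 c hck.1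
      rw [hck.2] at this
      exact absurd this (by simp)

theorem stopTime_eq_succ_iff {n : ℕ} :
    G.stopTime A ξ b = ((n + 1 : ℕ) : ℕ∞) ↔ G.Running A ξ b n ∧ ¬ G.Running A ξ b (n + 1) := by
  rw [← lt_stopTime_iff, ← lt_stopTime_iff, not_lt]
  constructor
  · intro h
    rw [h]
    exact ⟨by exact_mod_cast Nat.lt_succ_self n, le_rfl⟩
  · rintro ⟨h1, h2⟩
    refine le_antisymm h2 ?_
    rw [Nat.cast_add, Nat.cast_one, ENat.add_one_le_iff (ENat.natCast_ne_top n)]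
    exact h1

theorem stopTime_eq_zero_iff : G.stopTime A ξ b = 0 ↔ ¬ G.Running A ξ b 0 := by
  rw [← lt_stopTime_iff, Nat.cast_zero, not_lt, nonpos_iff_eq_zero]

end Deterministic

section Measurability

variable {V : Type*} [DecidableEq V] [MeasurableSpace V]
  [DiscreteMeasurableSpace V] {G : ConnectionGraph V} {Ω : Type*} [MeasurableSpace Ω]
  {X : ℕ → Ω → V} {B : G.OrientedCycle → ℕ → Ω → Bool}

/-- The set may depend on the next position: both the update of the path and the cycle closed at
step n + 1 are functions of this pair. -/
theorem measurableSet_loopErased [Finite V] (hX : ∀ n, Measurable (X n)) (n : ℕ)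
    (s : V → Set (List V)) :
    MeasurableSet {ω | loopErased (fun k => X k ω) n ∈ s (X (n + 1) ω)} := by
  have h1 : ∀ z, MeasurableSet {ω | X (n + 1) ω = z} := fun z =>
    hX (n + 1) (measurableSet_singleton z)
  induction n generalizing s with
  | zero =>
    have : {ω | loopErased (fun k => X k ω) 0 ∈ s (X 1 ω)} =
        ⋃ z, {ω | X 1 ω = z} ∩ X 0 ⁻¹' {y | [y] ∈ s z} := by
      ext ω
      simp [loopErased]
    rw [this]
    exact MeasurableSet.iUnion fun z => (h1 z).inter (hX 0 (MeasurableSet.of_discrete))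
  | succ n ih =>
    have : {ω | loopErased (fun k => X k ω) (n + 1) ∈ s (X (n + 1 + 1) ω)} =
        ⋃ z, {ω | X (n + 1 + 1) ω = z} ∩
          {ω | loopErased (fun k => X k ω) n ∈ {γ | stepPath γ (X (n + 1) ω) ∈ s z}} := by
      ext ω
      simp [loopErased_succ]
    rw [this]
    exact MeasurableSet.iUnion fun z => (h1 z).inter
      (ih (fun v => {γ | stepPath γ v ∈ s z}) fun z => hX (n + 1) (measurableSet_singleton z))

theorem measurableSet_running [Fintype V] (hX : ∀ n, Measurable (X n))
    (hB : ∀ c n, Measurable (B c n)) (A : Finset V) (n : ℕ) :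
    MeasurableSet {ω | G.Running A (fun k => X k ω) (fun c k => B c k ω) n} := by
  have hcl : ∀ c k, MeasurableSet {ω | G.Closes (fun k => X k ω) c k} := by
    intro c k
    cases k with
    | zero => simp [Closes]
    | succ k =>
      exact measurableSet_loopErased hX k
        fun z => {γ | c.1 = ((γ.dropWhile (fun v => v ≠ z) : List V) : Cycle V)}
  have : {ω | G.Running A (fun k => X k ω) (fun c k => B c k ω) n} =
      ⋂ k ∈ Finset.range (n + 1), (X k ⁻¹' {v | v ∉ A}) ∩ ⋂ c,
        ({ω | G.Closes (fun k => X k ω) c k}ᶜ ∪ B c k ⁻¹' {false}) := by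
    ext ω
    simp only [Running, Set.mem_ofPred_eq, Set.mem_iInter, Set.mem_inter_iff, Finset.mem_range,
      Nat.lt_succ_iff, Set.mem_preimage, Set.mem_union, Set.mem_compl_iff, Set.mem_singleton_iff,
      imp_iff_not_or]
  rw [this]
  refine Finset.measurableSet_biInter _ fun k _ => ?_
  exact (hX k MeasurableSet.of_discrete).inter (MeasurableSet.iInter fun c =>
    (hcl c k).compl.union (hB c k (measurableSet_singleton _)))

theorem measurableSet_stopTime [Fintype V] (hX : ∀ n, Measurable (X n))
    (hB : ∀ c n, Measurable (B c n)) (A : Finset V) (n : ℕ) (γ : List V) :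
    MeasurableSet {ω | G.stopTime A (fun k => X k ω) (fun c k => B c k ω) = (n : ℕ∞) ∧
      loopErased (fun k => X k ω) (n - 1) = γ} := by
  have h1 := measurableSet_loopErased hX (n - 1) fun _ => {γ}
  cases n with
  | zero =>
    simp only [Nat.cast_zero, stopTime_eq_zero_iff]
    exact (measurableSet_running hX hB A 0).compl.inter h1
  | succ n =>
    simp only [stopTime_eq_succ_iff]
    exact ((measurableSet_running hX hB A n).inter
      (measurableSet_running hX hB A (n + 1)).compl).inter h1

end Measurability

end ConnectionGraph

--BEGIN
namespace ConnectionGraph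

/-! ### Independence of the inputs and Markov property. -/

section Input

variable {V : Type*} [Fintype V] [MeasurableSpace V] {G : ConnectionGraph V} {Ω : Type*}
  [mΩ : MeasurableSpace Ω] {P : Measure Ω} {X : V → ℕ → Ω → V}
  {B : V → G.OrientedCycle → ℕ → Ω → Bool}

/-- The `σ`-algebras generated by each of the walks and by each of the acceptance variables. -/
@[reducible]
def inputSigma (X : V → ℕ → Ω → V) (B : V → G.OrientedCycle → ℕ → Ω → Bool) :
    V ⊕ (V × G.OrientedCycle × ℕ) → MeasurableSpace Ω
  | .inl x => MeasurableSpace.comap (fun ω n => X x n ω) inferInstance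
  | .inr i => MeasurableSpace.comap (B i.1 i.2.1 i.2.2) inferInstance

namespace IsInput

variable {α : G.OrientedCycle → ℝ} (H : G.IsInput α P X B)
include H

theorem iIndep_inputSigma : iIndep (inputSigma X B) P := by
  rw [iIndep_iff]
  intro s f hf
  have hs : (⋂ i ∈ s, f i) =
      (⋂ x ∈ s.toLeft, f (.inl x)) ∩ ⋂ i ∈ s.toRight, f (.inr i) := by
    ext ω
    simp
  have hL : ∀ x ∈ s.toLeft, MeasurableSet[inputSigma X B (.inl x)] (f (.inl x)) :=
    fun x hx => hf _ (Finset.mem_toLeft.1 hx)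
  have hR : ∀ i ∈ s.toRight, MeasurableSet[inputSigma X B (.inr i)] (f (.inr i)) :=
    fun i hi => hf _ (Finset.mem_toRight.1 hi)
  rw [hs, H.indep_XB.meas_inter, H.indep_X.meas_biInter hL, H.indep_B.meas_biInter hR,
    ← Finset.toLeft_disjSum_toRight (u := s), Finset.prod_disjSum, Finset.toLeft_disjSum,
    Finset.toRight_disjSum]
  · refine Finset.measurableSet_biInter _ fun x hx => ?_
    have : inputSigma X B (.inl x) ≤
        MeasurableSpace.comap (fun ω x n => X x n ω) inferInstance := by
      refine Measurable.comap_le ?_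
      exact (measurable_pi_apply x).comp
        (comap_measurable (fun ω (x : V) (n : ℕ) => X x n ω))
    exact this _ (hL x hx)
  · refine Finset.measurableSet_biInter _ fun i hi => ?_
    have : inputSigma X B (.inr i) ≤
        MeasurableSpace.comap (fun ω x c n => B x c n ω) inferInstance := by
      refine Measurable.comap_le ?_
      exact (((measurable_pi_apply i.2.2).comp (measurable_pi_apply i.2.1)).comp
        (measurable_pi_apply i.1)).comp
        (comap_measurable (fun ω (x : V) (c : G.OrientedCycle) (n : ℕ) => B x c n ω))
    exact this _ (hR i hi)

theorem inputSigma_le (i : V ⊕ (V × G.OrientedCycle × ℕ)) : inputSigma X B i ≤ mΩ := by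
  cases i with
  | inl x => exact (measurable_pi_lambda _ fun n => H.measurable_X x n).comap_le
  | inr i => exact (H.measurable_B _ _ _).comap_le

theorem measureReal_path {x : V} {n : ℕ} {ξ : ℕ → V} (hξ : ξ 0 = x) :
    P.real {ω | ∀ k ≤ n, X x k ω = ξ k} =
      ∏ k ∈ Finset.range n, G.p (ξ k) (ξ (k + 1)) := by
  rw [measureReal_def, H.chain x n ξ hξ,
    ENNReal.toReal_ofReal (Finset.prod_nonneg fun _ _ => p_nonneg _ _)]

end IsInput

theorem measurableSet_path [DiscreteMeasurableSpace V] (hX : ∀ x n, Measurable (X x n)) (x : V)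
    (n : ℕ) (η : Fin (n + 1) → V) :
    MeasurableSet ((fun ω (k : Fin (n + 1)) => X x k ω) ⁻¹' {η}) :=
  (measurable_pi_lambda _ fun k : Fin (n + 1) => hX x k) (measurableSet_singleton η)

variable [IsProbabilityMeasure P] (H : G.IsInput (fun c => 1 - Real.cos c.angle) P X B)

include H

theorem measureReal_reject (x : V) (c : G.OrientedCycle) (n : ℕ) :
    P.real {ω | B x c n ω = false} = Real.cos c.angle := by
  have h1 : {ω | B x c n ω = false} = {ω | B x c n ω = true}ᶜ := by
    ext ω; simp
  have hm : MeasurableSet {ω | B x c n ω = true} :=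
    H.measurable_B x c n (measurableSet_singleton true)
  rw [h1, probReal_compl_eq_one_sub hm, measureReal_def, H.bernoulli, ENNReal.toReal_ofReal]
  · ring
  · have := Real.cos_le_one c.angle
    linarith

variable [DecidableEq V] [DiscreteMeasurableSpace V]

/-- The probability that the walk follows the path `ξ` without being stopped. -/
theorem measureReal_running_path {x : V} {A : Finset V} {n : ℕ} {ξ : ℕ → V} (hξ : ξ 0 = x)
    (hA : ∀ k ≤ n, ξ k ∉ A) :
    P.real {ω | (∀ k ≤ n, X x k ω = ξ k) ∧
        G.Running A (fun k => X x k ω) (fun c k => B x c k ω) n} =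
      ∏ k ∈ Finset.range n,
        (G.p (ξ k) (ξ (k + 1)) * G.keepProb (loopErased ξ k) (ξ (k + 1))) := by
  classical
  -- The acceptance variables consulted along ξ. Once the trajectory is fixed, the closed cycles are
  -- deterministic, so the event is an intersection of events on independent inputs. Step 0 closes
  -- nothing, hence the shift by one.
  let F : Finset (V × G.OrientedCycle × ℕ) :=
    ((Finset.range n).sigma fun k => Finset.univ.filter fun c : G.OrientedCycle =>
      G.Closes ξ c (k + 1)).map ⟨fun a => (x, a.2, a.1 + 1), by
        rintro ⟨a, b⟩ ⟨a', b'⟩ h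
        simp only [Prod.mk.injEq, true_and, Nat.add_right_cancel_iff] at h
        obtain ⟨rfl, rfl⟩ := h
        rfl⟩
  let E : V ⊕ (V × G.OrientedCycle × ℕ) → Set Ω :=
    Sum.elim (fun _ => {ω | ∀ k ≤ n, X x k ω = ξ k}) fun i => {ω | B i.1 i.2.1 i.2.2 ω = false}
  have hE : {ω | (∀ k ≤ n, X x k ω = ξ k) ∧
      G.Running A (fun k => X x k ω) (fun c k => B x c k ω) n} =
      ⋂ i ∈ ({x} : Finset V).disjSum F, E i := by
    ext ω
    simp only [Set.mem_iInter, Finset.mem_disjSum, Set.mem_ofPred_eq]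
    constructor
    · rintro ⟨h1, h2⟩ i (⟨y, hy, rfl⟩ | ⟨i, hi, rfl⟩)
      · exact h1
      · simp only [F, Finset.mem_map, Finset.mem_sigma, Finset.mem_range, Finset.mem_filter,
          Finset.mem_univ, true_and, Sigma.exists] at hi
        obtain ⟨k, c, ⟨hk, hc⟩, rfl⟩ := hi
        refine (h2 (k + 1) hk).2 c ?_
        rwa [closes_congr G fun j hj => h1 j (hj.trans hk)]
    · intro h
      have h1 : ∀ k ≤ n, X x k ω = ξ k := h (.inl x) (Or.inl ⟨x, by simp, rfl⟩)
      refine ⟨h1, fun k hk => ⟨?_, fun c hc => ?_⟩⟩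
      · exact fun hk' => hA k hk (h1 k hk ▸ hk')
      · cases k with
        | zero => exact absurd hc (by simp [Closes])
        | succ k =>
          rw [closes_congr G fun j hj => h1 j (hj.trans hk)] at hc
          refine h (.inr (x, c, k + 1)) (Or.inr ⟨_, ?_, rfl⟩)
          simp only [F, Finset.mem_map, Finset.mem_sigma, Finset.mem_range, Finset.mem_filter,
            Finset.mem_univ, true_and, Sigma.exists]
          exact ⟨k, c, ⟨hk, hc⟩, rfl⟩
  have hEm : ∀ i ∈ ({x} : Finset V).disjSum F, MeasurableSet[inputSigma X B i] (E i) := by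
    intro i hi
    rw [Finset.mem_disjSum] at hi
    rcases hi with ⟨y, hy, rfl⟩ | ⟨i, hi, rfl⟩
    · rw [Finset.mem_singleton] at hy
      subst hy
      refine ⟨{f | ∀ k ≤ n, f k = ξ k}, ?_, rfl⟩
      have : {f : ℕ → V | ∀ k ≤ n, f k = ξ k} =
          ⋂ k ∈ Finset.range (n + 1), (fun f : ℕ → V => f k) ⁻¹' {ξ k} := by
        ext f
        simp
      rw [this]
      exact Finset.measurableSet_biInter _ fun k _ =>
        measurable_pi_apply k (measurableSet_singleton _)
    · exact ⟨{false}, measurableSet_singleton _, rfl⟩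
  rw [hE, measureReal_def, H.iIndep_inputSigma.meas_biInter hEm, Finset.prod_disjSum,
    Finset.prod_singleton, ENNReal.toReal_mul, ENNReal.toReal_prod, Finset.prod_mul_distrib]
  congr 1
  · exact H.measureReal_path hξ
  · rw [Finset.prod_map, Finset.prod_sigma]
    refine Finset.prod_congr rfl fun k _ => ?_
    rw [keepProb]
    refine Finset.prod_congr (by ext c; simp [Closes]) fun c _ => ?_
    exact measureReal_reject H x c (k + 1)

/-- The Markov property of the loop-erased path of the walk. -/
theorem measureReal_running_succ (x : V) {A : Finset V} (n : ℕ) {z : V} (hz : z ∉ A)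
    (γ : List V) :
    P.real {ω | G.Running A (fun k => X x k ω) (fun c k => B x c k ω) (n + 1) ∧
        loopErased (fun k => X x k ω) n = γ ∧ X x (n + 1) ω = z} =
      P.real {ω | G.Running A (fun k => X x k ω) (fun c k => B x c k ω) n ∧
        loopErased (fun k => X x k ω) n = γ} * (G.lastP γ z * G.keepProb γ z) := by
  rw [measureReal_eq_sum_inter_fiber (fun ω (k : Fin (n + 1)) => X x k ω) Finset.univ
      (fun η _ => measurableSet_path H.measurable_X x n η) (by simp),
    measureReal_eq_sum_inter_fiber (E := {ω | G.Running A (fun k => X x k ω)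
        (fun c k => B x c k ω) n ∧ loopErased (fun k => X x k ω) n = γ})
      (fun ω (k : Fin (n + 1)) => X x k ω) Finset.univ
      (fun η _ => measurableSet_path H.measurable_X x n η) (by simp), Finset.sum_mul]
  refine Finset.sum_congr rfl fun η _ => ?_
  -- The trajectory η continued by z; only its value at n + 1 matters afterwards.
  let ξ : ℕ → V := fun k => if h : k < n + 1 then η ⟨k, h⟩ else z
  have hfib : ∀ ω, (fun k : Fin (n + 1) => X x k ω) = η ↔ ∀ k ≤ n, X x k ω = ξ k := by
    intro ω
    constructor
    · rintro h k hk
      have := congrFun h ⟨k, Nat.lt_succ_of_le hk⟩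
      simp only [ξ, Nat.lt_succ_of_le hk, dif_pos]
      exact this
    · intro h
      ext k
      have := h k (Nat.le_of_lt_succ k.2)
      exact this.trans (by simp [ξ, Nat.le_of_lt_succ k.2])
  have hξz : ξ (n + 1) = z := by simp [ξ]
  by_cases hbad : ξ 0 = x ∧ (∀ k ≤ n, ξ k ∉ A) ∧ loopErased ξ n = γ
  · obtain ⟨h0, hA, hγ⟩ := hbad
    have e1 : {ω | G.Running A (fun k => X x k ω) (fun c k => B x c k ω) (n + 1) ∧
        loopErased (fun k => X x k ω) n = γ ∧ X x (n + 1) ω = z} ∩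
        (fun ω (k : Fin (n + 1)) => X x k ω) ⁻¹' {η} =
        {ω | (∀ k ≤ n + 1, X x k ω = ξ k) ∧
          G.Running A (fun k => X x k ω) (fun c k => B x c k ω) (n + 1)} := by
      ext ω
      simp only [Set.mem_inter_iff, Set.mem_ofPred_eq, Set.mem_preimage, Set.mem_singleton_iff,
        hfib]
      constructor
      · rintro ⟨⟨h1, -, h3⟩, h4⟩
        refine ⟨fun k hk => ?_, h1⟩
        rcases Nat.le_succ_iff.1 hk with hk | rfl
        · exact h4 k hk
        · rw [h3, hξz]
      · rintro ⟨h1, h2⟩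
        have h4 : ∀ k ≤ n, X x k ω = ξ k := fun k hk => h1 k (hk.trans (Nat.le_succ n))
        exact ⟨⟨h2, (loopErased_congr h4).trans hγ, (h1 _ le_rfl).trans hξz⟩, h4⟩
    have e2 : {ω | G.Running A (fun k => X x k ω) (fun c k => B x c k ω) n ∧
        loopErased (fun k => X x k ω) n = γ} ∩
        (fun ω (k : Fin (n + 1)) => X x k ω) ⁻¹' {η} =
        {ω | (∀ k ≤ n, X x k ω = ξ k) ∧
          G.Running A (fun k => X x k ω) (fun c k => B x c k ω) n} := by
      ext ω
      simp only [Set.mem_inter_iff, Set.mem_ofPred_eq, Set.mem_preimage, Set.mem_singleton_iff,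
        hfib]
      constructor
      · rintro ⟨⟨h1, -⟩, h4⟩
        exact ⟨h4, h1⟩
      · rintro ⟨h4, h2⟩
        exact ⟨⟨h2, (loopErased_congr h4).trans hγ⟩, h4⟩
    rw [e1, e2, measureReal_running_path H h0, measureReal_running_path H h0 hA,
      Finset.prod_range_succ, hγ, hξz]
    · congr 2
      rw [lastP, ← hγ, getLast?_loopErased, Option.elim_some]
    · intro k hk
      rcases Nat.le_succ_iff.1 hk with hk | rfl
      · exact hA k hk
      · rwa [hξz]
  -- A trajectory that starts elsewhere, meets A or has another loop erasure contributes zero to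
  -- both sides.
  · have hnull : ∀ E : Set Ω, (∀ ω ∈ E, X x 0 ω = x → (∀ k ≤ n, X x k ω = ξ k) → False) →
        P.real (E ∩ (fun ω (k : Fin (n + 1)) => X x k ω) ⁻¹' {η}) = 0 := by
      intro E hE
      rw [measureReal_def, measure_eq_zero_iff_ae_notMem.2, ENNReal.toReal_zero]
      filter_upwards [H.start x] with ω hω h
      exact hE ω h.1 hω ((hfib ω).1 h.2)
    rw [hnull, hnull, zero_mul]
    · rintro ω ⟨h1, h2⟩ h0 h4
      exact hbad ⟨(h4 0 (Nat.zero_le n)).symm.trans h0, fun k hk => h4 k hk ▸ (h1 k hk).1,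
        (loopErased_congr h4).symm.trans h2⟩
    · rintro ω ⟨h1, h2, -⟩ h0 h4
      exact hbad ⟨(h4 0 (Nat.zero_le n)).symm.trans h0,
        fun k hk => h4 k hk ▸ (h1 k (hk.trans (Nat.le_succ n))).1,
        (loopErased_congr h4).symm.trans h2⟩

end Input

end ConnectionGraph

--BEGIN
namespace ConnectionGraph

/-! ### Generating function of a single iteration. -/

section Iteration

variable {V : Type*} [Fintype V] [DecidableEq V] (G : ConnectionGraph V)

/-- The probability that the walk with loop-erased path `γ` stops at the next step. -/
def exitProb (S : Finset V) (γ : List V) : ℝ := 1 - ∑ z ∈ S, G.lastP γ z * G.keepProb γ z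

variable {G}

/-- The Green equation at t = 1 is summed over all paths: the row sums of 1 - Q are the exit
probabilities, and only the source at [x] remains on the right. -/
theorem sum_pathWeight_mul_exitProb (hdeg : ∀ x, G.deg x ≠ 0) {S : Finset V} {x : V}
    (hx : x ∈ S) :
    ∑ γ ∈ nodupLists S, G.pathWeight 1 x γ * G.cycleDet 1 (S \ γ.toFinset) * G.exitProb S γ =
      G.cycleDet 1 S := by
  have h := congrArg (fun f => ∑ γ, f γ) (vecMul_one_sub_pathMatrix hdeg 1 S x)
  have hx' : [x] ∈ nodupLists S := mem_nodupLists.2 ⟨by simp, by simpa using hx⟩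
  have hr : ∑ γ : nodupLists S, (if γ.1 = [x] then G.cycleDet 1 S else 0) = G.cycleDet 1 S := by
    rw [Finset.sum_eq_single ⟨[x], hx'⟩]
    · simp
    · intro b _ hb
      rw [if_neg fun h => hb (Subtype.ext h)]
    · simp
  rw [hr] at h
  rw [← h, ← Finset.sum_coe_sort]
  simp only [one_smul, Matrix.vecMul, dotProduct]
  rw [Finset.sum_comm]
  refine Finset.sum_congr rfl fun γ _ => ?_
  rw [← Finset.mul_sum]
  congr 1
  simp only [Matrix.sub_apply, Finset.sum_sub_distrib, sum_pathMatrix, exitProb, Matrix.one_apply]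
  simp

variable [MeasurableSpace V] [DiscreteMeasurableSpace V] {Ω : Type*}
  [mΩ : MeasurableSpace Ω] {P : Measure Ω} [IsProbabilityMeasure P]
  {X : V → ℕ → Ω → V} {B : V → G.OrientedCycle → ℕ → Ω → Bool}
  (H : G.IsInput (fun c => 1 - Real.cos c.angle) P X B)

variable (P X B) in
/-- The probability that the walk from `x` is not stopped up to time `n` and that its loop-erased
path is then `γ`. -/
def runningProb (x : V) (A : Finset V) (n : ℕ) (γ : List V) : ℝ :=
  P.real {ω | G.Running A (fun k => X x k ω) (fun c k => B x c k ω) n ∧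
    loopErased (fun k => X x k ω) n = γ}

variable (P X B) in
/-- The probability that the walk from `x` is stopped at time `n` and that its loop-erased
path one step before is `γ`. -/
def branchProb (x : V) (A : Finset V) (n : ℕ) (γ : List V) : ℝ :=
  P.real {ω | G.stopTime A (fun k => X x k ω) (fun c k => B x c k ω) = (n : ℕ∞) ∧
    loopErased (fun k => X x k ω) (n - 1) = γ}

include H

omit [DiscreteMeasurableSpace V] [IsProbabilityMeasure P] in
theorem ae_running_zero {x : V} {A : Finset V} (hx : x ∉ A) :
    ∀ᵐ ω ∂P, G.Running A (fun k => X x k ω) (fun c k => B x c k ω) 0 := by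
  filter_upwards [H.start x] with ω hω k hk
  obtain rfl : k = 0 := by omega
  exact ⟨by simpa [hω] using hx, fun c hc => absurd hc (by simp [Closes])⟩

omit [DiscreteMeasurableSpace V] in
theorem runningProb_zero {x : V} {A : Finset V} (hx : x ∉ A) (γ : List V) :
    runningProb P X B x A 0 γ = if γ = [x] then 1 else 0 := by
  rw [runningProb]
  split_ifs with h
  · have : ∀ᵐ ω ∂P, ω ∈ {ω | G.Running A (fun k => X x k ω) (fun c k => B x c k ω) 0 ∧
        loopErased (fun k => X x k ω) 0 = γ} := by
      filter_upwards [ae_running_zero H hx, H.start x] with ω h1 h2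
      exact ⟨h1, by rw [h]; simp [loopErased, h2]⟩
    have h1 := (measure_congr (Filter.eventuallyEq_univ.2 this)).trans measure_univ
    exact (congrArg ENNReal.toReal h1).trans ENNReal.toReal_one
  · rw [measureReal_def, measure_eq_zero_iff_ae_notMem.2, ENNReal.toReal_zero]
    filter_upwards [H.start x] with ω h2 h3
    exact h (by simpa [loopErased, h2] using h3.2.symm)

theorem runningProb_succ {x : V} {A : Finset V} (n : ℕ) :
    (fun γ : nodupLists Aᶜ => runningProb P X B x A (n + 1) γ.1) =
      (fun γ : nodupLists Aᶜ => runningProb P X B x A n γ.1) ᵥ* G.pathMatrix Aᶜ := by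
  ext γ'
  simp only [Matrix.vecMul, dotProduct, pathMatrix, Matrix.of_apply]
  rw [Finset.sum_coe_sort (nodupLists Aᶜ) fun γ => runningProb P X B x A n γ *
    ∑ z ∈ Aᶜ, if stepPath γ z = γ'.1 then G.lastP γ z * G.keepProb γ z else 0, runningProb,
    measureReal_eq_sum_inter_fiber (fun ω => (loopErased (fun k => X x k ω) n, X x (n + 1) ω))
      (nodupLists Aᶜ ×ˢ Aᶜ), Finset.sum_product]
  · refine Finset.sum_congr rfl fun γ _ => ?_
    rw [Finset.mul_sum]
    refine Finset.sum_congr rfl fun z hz => ?_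
    rw [Finset.mem_compl] at hz
    split_ifs with hs
    · rw [runningProb, ← measureReal_running_succ H x n hz]
      congr 1
      ext ω
      simp only [Set.mem_inter_iff, Set.mem_ofPred_eq, Set.mem_preimage, Set.mem_singleton_iff,
        Prod.mk.injEq, loopErased_succ]
      constructor
      · rintro ⟨⟨h1, -⟩, h2, h3⟩
        exact ⟨h1, h2, h3⟩
      · rintro ⟨h1, h2, h3⟩
        exact ⟨⟨h1, by rw [h2, h3, hs]⟩, h2, h3⟩
    · rw [mul_zero]
      convert measureReal_empty
      ext ω
      simp only [Set.mem_inter_iff, Set.mem_ofPred_eq, Set.mem_preimage, Set.mem_singleton_iff,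
        Prod.mk.injEq, loopErased_succ, Set.mem_empty_iff_false, iff_false, not_and]
      rintro ⟨-, h1⟩ h2 h3
      rw [h2, h3] at h1
      exact hs h1
  · rintro ⟨γ, z⟩ -
    have h1 := measurableSet_loopErased (H.measurable_X x) n fun z' => {γ₀ | γ₀ = γ ∧ z' = z}
    convert h1 using 1
    ext ω
    simp
  · refine Filter.Eventually.of_forall fun ω hω => ?_
    rw [Finset.mem_product]
    exact ⟨loopErased_mem_nodupLists fun k hk =>
      Finset.mem_compl.2 (hω.1 k (hk.trans (Nat.le_succ n))).1,
      Finset.mem_compl.2 (hω.1 (n + 1) le_rfl).1⟩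

theorem branchProb_succ {x : V} {A : Finset V} (n : ℕ) (γ : List V) :
    branchProb P X B x A (n + 1) γ = runningProb P X B x A n γ * G.exitProb Aᶜ γ := by
  have hm := measurableSet_running (H.measurable_X x) (H.measurable_B x) A (n + 1)
  have h1 : runningProb P X B x A n γ = P.real {ω |
      G.Running A (fun k => X x k ω) (fun c k => B x c k ω) (n + 1) ∧
        loopErased (fun k => X x k ω) n = γ} + branchProb P X B x A (n + 1) γ := by
    rw [runningProb, ← measureReal_inter_add_sdiff (ht := hm), branchProb]
    congr 2
    · ext ω
      simp only [Set.mem_inter_iff, Set.mem_ofPred_eq]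
      constructor
      · rintro ⟨⟨-, h2⟩, h3⟩
        exact ⟨h3, h2⟩
      · rintro ⟨h3, h2⟩
        exact ⟨⟨h3.mono (Nat.le_succ n), h2⟩, h3⟩
    · ext ω
      simp only [Set.mem_sdiff, Set.mem_ofPred_eq, stopTime_eq_succ_iff, Nat.add_sub_cancel]
      tauto
  have h2 : P.real {ω | G.Running A (fun k => X x k ω) (fun c k => B x c k ω) (n + 1) ∧
      loopErased (fun k => X x k ω) n = γ} = runningProb P X B x A n γ *
        ∑ z ∈ Aᶜ, G.lastP γ z * G.keepProb γ z := by
    rw [measureReal_eq_sum_inter_fiber (X x (n + 1)) Aᶜ, Finset.mul_sum]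
    · refine Finset.sum_congr rfl fun z hz => ?_
      rw [runningProb, ← measureReal_running_succ H x n (Finset.mem_compl.1 hz)]
      congr 1
      ext ω
      simp [and_assoc]
    · exact fun z _ => H.measurable_X x (n + 1) (measurableSet_singleton z)
    · exact Filter.Eventually.of_forall fun ω hω => Finset.mem_compl.2 (hω.1 (n + 1) le_rfl).1
  rw [h2] at h1
  rw [exitProb]
  linarith

omit [DiscreteMeasurableSpace V] [IsProbabilityMeasure P] in
theorem branchProb_zero {x : V} {A : Finset V} (hx : x ∉ A) (γ : List V) :
    branchProb P X B x A 0 γ = 0 := by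
  rw [branchProb, measureReal_def, measure_eq_zero_iff_ae_notMem.2, ENNReal.toReal_zero]
  filter_upwards [ae_running_zero H hx] with ω h1 h2
  exact stopTime_eq_zero_iff.1 h2.1 h1

/-- Visits to γ are counted by the Green function divided by D_t(Aᶜ); the stopping step adds a
factor t and the exit probability. -/
theorem hasSum_branchProb (hdeg : ∀ x, G.deg x ≠ 0) (hQ : ∀ S, IsTransient (G.pathMatrix S))
    {x : V} {A : Finset V} (hx : x ∉ A) {t : ℝ} (ht : |t| ≤ 1) {γ : List V}
    (hγ : γ ∈ nodupLists Aᶜ) :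
    HasSum (fun n => t ^ n * branchProb P X B x A n γ)
      (t * (G.pathWeight t x γ * G.cycleDet t (Aᶜ \ γ.toFinset) / G.cycleDet t Aᶜ) *
        G.exitProb Aᶜ γ) := by
  have hD := cycleDet_ne_zero hdeg hQ ht Aᶜ
  have hU : (fun γ : nodupLists Aᶜ => (G.cycleDet t Aᶜ)⁻¹ *
      (G.pathWeight t x γ.1 * G.cycleDet t (Aᶜ \ γ.1.toFinset))) ᵥ*
        (1 - t • G.pathMatrix Aᶜ) =
      fun γ : nodupLists Aᶜ => runningProb P X B x A 0 γ.1 := by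
    have h1 := congrArg ((G.cycleDet t Aᶜ)⁻¹ • ·) (vecMul_one_sub_pathMatrix hdeg t Aᶜ x)
    rw [← Matrix.smul_vecMul] at h1
    refine h1.trans ?_
    ext γ
    simp only [Pi.smul_apply, smul_eq_mul, runningProb_zero H hx, mul_ite, mul_zero,
      inv_mul_cancel₀ hD]
  have h := (hQ Aᶜ).hasSum_iterate
    (u := fun n (γ : nodupLists Aᶜ) => runningProb P X B x A n γ.1)
    (fun _ => measureReal_nonneg) (fun n => runningProb_succ H n) ht hU ⟨γ, hγ⟩
  have h2 := (h.mul_left t).mul_right (G.exitProb Aᶜ γ)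
  have h3 : HasSum (fun n => t ^ (n + 1) * branchProb P X B x A (n + 1) γ)
      (t * (G.pathWeight t x γ * G.cycleDet t (Aᶜ \ γ.toFinset) / G.cycleDet t Aᶜ) *
        G.exitProb Aᶜ γ) := by
    have e1 : ∀ n, t ^ (n + 1) * branchProb P X B x A (n + 1) γ =
        t * (t ^ n * runningProb P X B x A n γ) * G.exitProb Aᶜ γ := fun n => by
      rw [branchProb_succ H]
      ring
    simp only [e1]
    rw [div_eq_inv_mul]
    exact h2
  -- The omitted term n = 0 is null, since the walk starts outside A and closes nothing at time 0.
  have h4 := (hasSum_nat_add_iff (f := fun n => t ^ n * branchProb P X B x A n γ) 1).1 h3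
  simpa [branchProb_zero H hx] using h4

end Iteration

end ConnectionGraph

--BEGIN
namespace ConnectionGraph

theorem hasSum_mul_antidiagonal {f g : ℕ → ℝ} {a b : ℝ} (hf : HasSum f a) (hg : HasSum g b) :
    HasSum (fun N => ∑ i ∈ Finset.range (N + 1), f i * g (N - i)) (a * b) := by
  have h1 := summable_norm_sum_mul_range_of_summable_norm hf.summable.norm hg.summable.norm
  have h2 := tsum_mul_tsum_eq_tsum_sum_range_of_summable_norm hf.summable.norm hg.summable.norm
  rw [hf.tsum_eq, hg.tsum_eq] at h2
  rw [h2]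
  exact h1.of_norm.hasSum

section RemainingTime

variable {V : Type*} [Fintype V] [DecidableEq V] (G : ConnectionGraph V)

theorem notMem_of_nextNode_eq_some {ι : Fin (Fintype.card V) ≃ V} {A : Finset V} {x : V}
    (h : nextNode ι A = some x) : x ∉ A := by
  rw [nextNode, Option.map_eq_some_iff] at h
  obtain ⟨k, hk, rfl⟩ := h
  simpa using (Fin.find?_eq_some_iff.1 hk).1

theorem nextNode_eq_none_iff {ι : Fin (Fintype.card V) ≃ V} {A : Finset V} :
    nextNode ι A = none ↔ A = Finset.univ := by
  rw [nextNode, Option.map_eq_none_iff, Fin.find?_eq_none_iff, Finset.eq_univ_iff_forall]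
  constructor
  · intro h v
    simpa using h (ι.symm v)
  · intro h k
    simpa using h (ι k)

/-- The number of steps made by CyclePopping in `L` iterations from the set of nodes `A`. -/
def remainingTime (ι : Fin (Fintype.card V) ≃ V) (ξ : V → ℕ → V)
    (b : V → G.OrientedCycle → ℕ → Bool) : ℕ → Finset V → ℕ∞
  | 0, _ => 0
  | L + 1, A =>
    match nextNode ι A with
    | none => 0
    | some x => G.stopTime A (ξ x) (b x) + remainingTime ι ξ b L
        (A ∪ (loopErased (ξ x) ((G.stopTime A (ξ x) (b x)).toNat - 1)).toFinset)

variable {G} {ι : Fin (Fintype.card V) ≃ V} {ξ : V → ℕ → V} {b : V → G.OrientedCycle → ℕ → Bool}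

theorem remainingTime_succ_some {L : ℕ} {A : Finset V} {x : V} (h : nextNode ι A = some x) :
    G.remainingTime ι ξ b (L + 1) A = G.stopTime A (ξ x) (b x) + G.remainingTime ι ξ b L
      (A ∪ (loopErased (ξ x) ((G.stopTime A (ξ x) (b x)).toNat - 1)).toFinset) := by
  rw [remainingTime]
  simp only [h]

theorem remainingTime_of_none {A : Finset V} (h : nextNode ι A = none) (L : ℕ) :
    G.remainingTime ι ξ b L A = 0 := by
  cases L with
  | zero => rfl
  | succ L =>
    rw [remainingTime]
    simp only [h]

/-- `nodes` recurses on the last iteration and `remainingTime` on the first; the offset k lets the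
induction peel off the first one. -/
theorem sum_iterSteps (L k : ℕ) :
    ∑ ℓ ∈ Finset.range L, G.iterSteps ι ξ b (ℓ + k) =
      G.remainingTime ι ξ b L (G.nodes ι ξ b k) := by
  induction L generalizing k with
  | zero => rfl
  | succ L ih =>
    have h1 : ∀ ℓ, ℓ + 1 + k = ℓ + (k + 1) := fun ℓ => by omega
    rw [Finset.sum_range_succ', Finset.sum_congr rfl fun ℓ _ => by rw [h1], ih (k + 1), zero_add]
    cases h : nextNode ι (G.nodes ι ξ b k) with
    | none =>
      have h2 : G.nodes ι ξ b (k + 1) = G.nodes ι ξ b k := by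
        simp only [nodes, h]
      rw [h2, remainingTime_of_none h, remainingTime_of_none h, iterSteps]
      simp [h]
    | some x =>
      rw [remainingTime_succ_some h, iterSteps, nodes]
      simp only [h]
      rw [add_comm]

theorem runningTime_eq_remainingTime :
    G.runningTime ι ξ b = G.remainingTime ι ξ b (Fintype.card V) ∅ := by
  rw [runningTime, ← nodes.eq_1 G ι ξ b, ← sum_iterSteps]
  rfl

theorem remainingTime_succ_eq_iff {L : ℕ} {A : Finset V} {x : V} (h : nextNode ι A = some x)
    {N : ℕ} :
    G.remainingTime ι ξ b (L + 1) A = (N : ℕ∞) ↔ ∃ i ≤ N,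
      G.stopTime A (ξ x) (b x) = (i : ℕ∞) ∧
        G.remainingTime ι ξ b L (A ∪ (loopErased (ξ x) (i - 1)).toFinset) = ((N - i : ℕ) : ℕ∞) := by
  rw [remainingTime_succ_some h]
  constructor
  · intro hN
    have h1 : G.stopTime A (ξ x) (b x) ≠ ⊤ := fun h => by simp [h] at hN
    obtain ⟨i, hi⟩ := ENat.ne_top_iff_exists.1 h1
    rw [← hi, ENat.toNat_natCast] at hN
    have h2 : G.remainingTime ι ξ b L (A ∪ (loopErased (ξ x) (i - 1)).toFinset) ≠ ⊤ :=
      fun h => by simp [h] at hN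
    obtain ⟨j, hj⟩ := ENat.ne_top_iff_exists.1 h2
    rw [← hj] at hN
    have h3 : i + j = N := by exact_mod_cast hN
    refine ⟨i, by omega, hi.symm, ?_⟩
    rw [← hj]
    congr 1
    omega
  · rintro ⟨i, hi, h1, h2⟩
    rw [h1, ENat.toNat_natCast, h2]
    exact_mod_cast Nat.add_sub_cancel' hi

variable [MeasurableSpace V] [DiscreteMeasurableSpace V] {Ω : Type*} {X : V → ℕ → Ω → V}
  {B : V → G.OrientedCycle → ℕ → Ω → Bool}

/-- Inputs attached to nodes of A are never read again, so measurability is required only outside A.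
This allows the σ-algebra generated by the unread inputs. -/
theorem measurableSet_remainingTime [MeasurableSpace Ω] (L : ℕ) {A : Finset V}
    (hX : ∀ y ∉ A, ∀ n, Measurable (X y n)) (hB : ∀ y ∉ A, ∀ c n, Measurable (B y c n)) (N : ℕ) :
    MeasurableSet {ω | G.remainingTime ι (fun x n => X x n ω) (fun x c n => B x c n ω) L A =
      (N : ℕ∞)} := by
  induction L generalizing A N with
  | zero => simp [remainingTime]
  | succ L ih =>
    cases h : nextNode ι A with
    | none => simp [remainingTime_of_none h]
    | some x =>
      have hx := notMem_of_nextNode_eq_some h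
      have : {ω | G.remainingTime ι (fun x n => X x n ω) (fun x c n => B x c n ω) (L + 1) A =
          (N : ℕ∞)} = ⋃ i ∈ Finset.range (N + 1), ⋃ γ ∈ nodupLists (Finset.univ : Finset V),
          {ω | G.stopTime A (fun k => X x k ω) (fun c k => B x c k ω) = (i : ℕ∞) ∧
            loopErased (fun k => X x k ω) (i - 1) = γ} ∩
          {ω | G.remainingTime ι (fun x n => X x n ω) (fun x c n => B x c n ω) L
            (A ∪ γ.toFinset) = ((N - i : ℕ) : ℕ∞)} := by
        ext ω
        simp only [Set.mem_ofPred_eq, remainingTime_succ_eq_iff h, Set.mem_iUnion, exists_prop,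
          Finset.mem_range, Nat.lt_succ_iff, Set.mem_inter_iff]
        constructor
        · rintro ⟨i, hi, h1, h2⟩
          exact ⟨i, hi, _, loopErased_mem_nodupLists fun k _ => Finset.mem_univ _, ⟨h1, rfl⟩, h2⟩
        · rintro ⟨i, hi, γ, -, ⟨h1, rfl⟩, h2⟩
          exact ⟨i, hi, h1, h2⟩
      rw [this]
      refine Finset.measurableSet_biUnion _ fun i _ => Finset.measurableSet_biUnion _ fun γ _ => ?_
      refine (measurableSet_stopTime (hX x hx) (hB x hx) A i γ).inter (ih ?_ ?_ _)
      · exact fun y hy => hX y fun h => hy (Finset.mem_union_left _ h)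
      · exact fun y hy => hB y fun h => hy (Finset.mem_union_left _ h)

variable [mΩ : MeasurableSpace Ω] {P : Measure Ω} [IsProbabilityMeasure P]

variable (ι P X B) in
/-- The law of the number of steps made in `L` iterations from the set of nodes `A`. -/
def remainingProb (L : ℕ) (A : Finset V) (N : ℕ) : ℝ :=
  P.real {ω | G.remainingTime ι (fun x n => X x n ω) (fun x c n => B x c n ω) L A = (N : ℕ∞)}

variable (H : G.IsInput (fun c => 1 - Real.cos c.angle) P X B)
include H

-- The current iteration reads only the inputs owned by x, the following ones only those owned by
-- nodes outside A', which contains x. These are disjoint families of independent σ-algebras.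
omit [IsProbabilityMeasure P] in
theorem measureReal_branch_inter (L : ℕ) {x : V} {A A' : Finset V} (hx : x ∈ A') (i j : ℕ)
    (γ : List V) :
    P.real ({ω | G.stopTime A (fun k => X x k ω) (fun c k => B x c k ω) = (i : ℕ∞) ∧
        loopErased (fun k => X x k ω) (i - 1) = γ} ∩
      {ω | G.remainingTime ι (fun x n => X x n ω) (fun x c n => B x c n ω) L A' = (j : ℕ∞)}) =
      branchProb P X B x A i γ * remainingProb ι X B P L A' j := by
  let owner : V ⊕ (V × G.OrientedCycle × ℕ) → V := Sum.elim id Prod.fst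
  have hdisj : Disjoint {k | owner k = x} {k | owner k ∉ A'} := by
    rw [Set.disjoint_left]
    intro k hk hk'
    rw [Set.mem_ofPred_eq] at hk
    exact hk' (hk ▸ hx)
  have hind := indep_iSup_of_disjoint H.inputSigma_le H.iIndep_inputSigma hdisj
  have hX : ∀ (s : Set (V ⊕ (V × G.OrientedCycle × ℕ))) (y : V), .inl y ∈ s → ∀ n,
      Measurable[⨆ k ∈ s, inputSigma X B k] (X y n) := by
    intro s y hy n
    have h1 : Measurable[inputSigma X B (.inl y)] (X y n) :=
      (measurable_pi_apply n).comp (comap_measurable (fun ω (n : ℕ) => X y n ω))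
    exact h1.mono (le_iSup₂ (f := fun k (_ : k ∈ s) => inputSigma X B k) _ hy) le_rfl
  have hB : ∀ (s : Set (V ⊕ (V × G.OrientedCycle × ℕ))) (y : V) c n, .inr (y, c, n) ∈ s →
      Measurable[⨆ k ∈ s, inputSigma X B k] (B y c n) := by
    intro s y c n hy
    have h1 : Measurable[inputSigma X B (.inr (y, c, n))] (B y c n) := comap_measurable (B y c n)
    exact h1.mono (le_iSup₂ (f := fun k (_ : k ∈ s) => inputSigma X B k) _ hy) le_rfl
  rw [branchProb, remainingProb, measureReal_def, (Indep_iff _ _ _).1 hind, ENNReal.toReal_mul]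
  · rfl
  · exact @measurableSet_stopTime V _ _ _ G Ω (⨆ k ∈ {k | owner k = x}, inputSigma X B k)
      (X x) (B x) _ (hX _ x rfl) (fun c n => hB _ x c n rfl) A i γ
  · exact @measurableSet_remainingTime V _ _ G ι _ _ Ω X B
      (⨆ k ∈ {k | owner k ∉ A'}, inputSigma X B k) L A' (fun y hy => hX _ y hy)
      (fun y hy c n => hB _ y c n hy) j

theorem remainingProb_succ {L : ℕ} {A : Finset V} {x : V} (h : nextNode ι A = some x) (N : ℕ) :
    remainingProb ι X B P (L + 1) A N = ∑ γ ∈ nodupLists Aᶜ, ∑ i ∈ Finset.range (N + 1),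
      branchProb P X B x A i γ * remainingProb ι X B P L (A ∪ γ.toFinset) (N - i) := by
  have hx := notMem_of_nextNode_eq_some h
  have hfib : ∀ (i : ℕ) (γ : List V), (fun ω => (G.stopTime A (fun k => X x k ω)
      (fun c k => B x c k ω), loopErased (fun k => X x k ω)
        ((G.stopTime A (fun k => X x k ω) (fun c k => B x c k ω)).toNat - 1))) ⁻¹'
          {((i : ℕ∞), γ)} =
      {ω | G.stopTime A (fun k => X x k ω) (fun c k => B x c k ω) = (i : ℕ∞) ∧
        loopErased (fun k => X x k ω) (i - 1) = γ} := by
    intro i γ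
    ext ω
    simp only [Set.mem_preimage, Set.mem_singleton_iff, Prod.mk.injEq, Set.mem_ofPred_eq]
    refine and_congr_right fun hi => ?_
    rw [hi, ENat.toNat_natCast]
  rw [remainingProb, measureReal_eq_sum_inter_fiber (fun ω => (G.stopTime A (fun k => X x k ω)
      (fun c k => B x c k ω), loopErased (fun k => X x k ω)
        ((G.stopTime A (fun k => X x k ω) (fun c k => B x c k ω)).toNat - 1)))
      (((Finset.range (N + 1)).map Nat.castEmbedding : Finset ℕ∞) ×ˢ nodupLists Aᶜ),
    Finset.sum_product_right]
  · refine Finset.sum_congr rfl fun γ _ => ?_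
    rw [Finset.sum_map]
    refine Finset.sum_congr rfl fun i hi => ?_
    have hiN : i ≤ N := Nat.lt_succ_iff.1 (Finset.mem_range.1 hi)
    rw [Nat.castEmbedding_apply, hfib]
    have hset : {ω | G.remainingTime ι (fun x n => X x n ω) (fun x c n => B x c n ω) (L + 1) A =
        (N : ℕ∞)} ∩ {ω | G.stopTime A (fun k => X x k ω) (fun c k => B x c k ω) = (i : ℕ∞) ∧
          loopErased (fun k => X x k ω) (i - 1) = γ} =
        {ω | G.stopTime A (fun k => X x k ω) (fun c k => B x c k ω) = (i : ℕ∞) ∧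
          loopErased (fun k => X x k ω) (i - 1) = γ} ∩
        {ω | G.remainingTime ι (fun x n => X x n ω) (fun x c n => B x c n ω) L
          (A ∪ γ.toFinset) = ((N - i : ℕ) : ℕ∞)} := by
      ext ω
      simp only [Set.mem_inter_iff, Set.mem_ofPred_eq, remainingTime_succ_eq_iff h]
      constructor
      · rintro ⟨⟨i', -, h1, h2⟩, h3, rfl⟩
        obtain rfl : i = i' := by exact_mod_cast h3.symm.trans h1
        exact ⟨⟨h3, rfl⟩, h2⟩
      · rintro ⟨⟨h1, rfl⟩, h2⟩
        exact ⟨⟨i, hiN, h1, h2⟩, h1, rfl⟩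
    rw [hset]
    by_cases hxγ : x ∈ γ
    · exact measureReal_branch_inter H L (by simp [hxγ]) i (N - i) γ
    -- Independence required x to be covered by γ; otherwise the event is null, as the loop-erased
    -- path almost surely starts at x.
    · have hnull : branchProb P X B x A i γ = 0 := by
        rw [branchProb, measureReal_def, measure_eq_zero_iff_ae_notMem.2, ENNReal.toReal_zero]
        filter_upwards [H.start x] with ω h1 h2
        refine hxγ ?_
        rw [← h2.2]
        refine List.mem_of_head? ?_
        rw [head?_loopErased, h1]
      rw [hnull, zero_mul]
      refine le_antisymm ?_ measureReal_nonneg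
      rw [branchProb] at hnull
      rw [← hnull]
      exact measureReal_mono Set.inter_subset_left
  · rintro ⟨τ, γ⟩ hτ
    rw [Finset.mem_product, Finset.mem_map] at hτ
    obtain ⟨⟨i, -, rfl⟩, -⟩ := hτ
    rw [Nat.castEmbedding_apply, hfib]
    exact measurableSet_stopTime (H.measurable_X x) (H.measurable_B x) A i γ
  · filter_upwards [ae_running_zero H hx] with ω h0 hω
    rw [remainingTime_succ_eq_iff h] at hω
    obtain ⟨i, hi, h1, -⟩ := hω
    rw [h1, ENat.toNat_natCast, Finset.mem_product]
    refine ⟨Finset.mem_map.2 ⟨i, Finset.mem_range.2 (Nat.lt_succ_of_le hi), rfl⟩, ?_⟩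
    cases i with
    | zero => exact absurd h0 (stopTime_eq_zero_iff.1 h1)
    | succ n =>
      exact loopErased_mem_nodupLists fun k hk =>
        Finset.mem_compl.2 ((stopTime_eq_succ_iff.1 h1).1 k hk).1

theorem hasSum_remainingProb (hdeg : ∀ x, G.deg x ≠ 0)
    (hQ : ∀ S, IsTransient (G.pathMatrix S)) {t : ℝ} (ht : |t| ≤ 1) {L : ℕ} {A : Finset V}
    (hL : Aᶜ.card ≤ L) :
    HasSum (fun N => t ^ N * remainingProb ι X B P L A N)
      (t ^ Aᶜ.card * G.cycleDet 1 Aᶜ / G.cycleDet t Aᶜ) := by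
  induction L generalizing A with
  | zero =>
    have hA : Aᶜ = ∅ := Finset.card_eq_zero.1 (by omega)
    have h0 : ∀ N, N ≠ 0 → t ^ N * remainingProb ι X B P 0 A N = 0 := by
      intro N hN
      have : {ω : Ω | (0 : ℕ∞) = (N : ℕ∞)} = ∅ := by
        ext ω
        simpa using fun h : (0 : ℕ∞) = N => hN (by exact_mod_cast h.symm)
      simp [remainingProb, remainingTime, this]
    have := hasSum_single 0 h0
    simpa [hA, cycleDet_empty, remainingProb, remainingTime] using this
  | succ L ih =>
    cases h : nextNode ι A with
    | none =>
      have hA : Aᶜ = ∅ := by rw [nextNode_eq_none_iff.1 h, Finset.compl_univ]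
      have h0 : ∀ N, N ≠ 0 → t ^ N * remainingProb ι X B P (L + 1) A N = 0 := by
        intro N hN
        have : {ω : Ω | (0 : ℕ∞) = (N : ℕ∞)} = ∅ := by
          ext ω
          simpa using fun h : (0 : ℕ∞) = N => hN (by exact_mod_cast h.symm)
        simp [remainingProb, remainingTime_of_none h, this]
      have := hasSum_single 0 h0
      simpa [hA, cycleDet_empty, remainingProb, remainingTime_of_none h] using this
    | some x =>
      have hx := notMem_of_nextNode_eq_some h
      have hxc : x ∈ Aᶜ := Finset.mem_compl.2 hx
      have hD := cycleDet_ne_zero hdeg hQ ht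
      have hterm : ∀ γ ∈ nodupLists Aᶜ, HasSum (fun N => ∑ i ∈ Finset.range (N + 1),
          (t ^ i * branchProb P X B x A i γ) *
            (t ^ (N - i) * remainingProb ι X B P L (A ∪ γ.toFinset) (N - i)))
          (t ^ Aᶜ.card * (G.pathWeight 1 x γ * G.cycleDet 1 (Aᶜ \ γ.toFinset) *
            G.exitProb Aᶜ γ) / G.cycleDet t Aᶜ) := by
        intro γ hγ
        have hb := hasSum_branchProb H hdeg hQ hx ht hγ
        by_cases hw : γ.head? = some x
        · obtain ⟨l, rfl⟩ : ∃ l, γ = x :: l := by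
            cases γ with
            | nil => simp at hw
            | cons y l => exact ⟨l, by simpa using hw⟩
          have hsub : (x :: l).toFinset ⊆ Aᶜ := fun v hv =>
            (mem_nodupLists.1 hγ).2 v (List.mem_toFinset.1 hv)
          have hcompl : (A ∪ (x :: l).toFinset)ᶜ = Aᶜ \ (x :: l).toFinset := by
            ext v
            simp only [Finset.mem_compl, Finset.mem_union, Finset.mem_sdiff, not_or]
          have hcard : (Aᶜ \ (x :: l).toFinset).card + (l.length + 1) = Aᶜ.card := by
            have h1 := Finset.card_sdiff_add_card_eq_card hsub
            rwa [List.toFinset_card_of_nodup (mem_nodupLists.1 hγ).1, List.length_cons] at h1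
          have hr := ih (A := A ∪ (x :: l).toFinset) (by rw [hcompl]; omega)
          rw [hcompl] at hr
          -- The Cauchy product of the two generating functions: D_t(Aᶜ∖γ) cancels, and t^(|γ|-1)
          -- from the path, t from the stopping step and t^|Aᶜ∖γ| from the rest combine to t^|Aᶜ|.
          convert hasSum_mul_antidiagonal hb hr using 1
          have h1 := hD (Aᶜ \ (x :: l).toFinset)
          have h2 := hD Aᶜ
          rw [← hcard]
          simp only [pathWeight, if_true, chainProd_mul_left, one_mul]
          field_simp
          ring
        · have hw0 : ∀ s, G.pathWeight s x γ = 0 := by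
            intro s
            cases γ with
            | nil => rfl
            | cons y l =>
              rw [pathWeight, if_neg]
              exact fun hy => hw (by simp [hy])
          have hnull : ∀ i, branchProb P X B x A i γ = 0 := by
            intro i
            rw [branchProb, measureReal_def, measure_eq_zero_iff_ae_notMem.2,
              ENNReal.toReal_zero]
            filter_upwards [H.start x] with ω h1 h2
            exact hw (by rw [← h2.2, head?_loopErased, h1])
          simp [hw0, hnull, hasSum_zero]
      have hsum := hasSum_sum hterm
      -- The dependence on t now factors out of the sum over γ, which equals D_1(Aᶜ).
      rw [← Finset.sum_div, ← Finset.mul_sum, sum_pathWeight_mul_exitProb hdeg hxc] at hsum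
      convert hsum using 1
      ext N
      rw [remainingProb_succ H h, Finset.mul_sum]
      refine Finset.sum_congr rfl fun γ _ => ?_
      rw [Finset.mul_sum]
      refine Finset.sum_congr rfl fun i hi => ?_
      have hiN : i ≤ N := Nat.lt_succ_iff.1 (Finset.mem_range.1 hi)
      rw [mul_mul_mul_comm, ← pow_add, Nat.add_sub_cancel' hiN]

end RemainingTime

end ConnectionGraph

--BEGIN
namespace ConnectionGraph

/-! ### From the law of T to its expectation. -/

section GeneratingFunction

variable {Ω : Type*} [MeasurableSpace Ω] {P : Measure Ω} [IsProbabilityMeasure P] {T : Ω → ℕ∞}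

theorem ae_ne_top_of_hasSum (hT : ∀ N : ℕ, MeasurableSet {ω | T ω = (N : ℕ∞)})
    (h : HasSum (fun N : ℕ => P.real {ω | T ω = (N : ℕ∞)}) 1) : ∀ᵐ ω ∂P, T ω ≠ ⊤ := by
  have hset : {ω | T ω ≠ ⊤} = ⋃ N : ℕ, {ω | T ω = (N : ℕ∞)} := by
    ext ω
    simp only [Set.mem_ofPred_eq, Set.mem_iUnion, ENat.ne_top_iff_exists, eq_comm]
  have hm : MeasurableSet {ω | T ω ≠ ⊤} := hset ▸ MeasurableSet.iUnion hT
  have hdisj : Pairwise (Function.onFun Disjoint fun N : ℕ => {ω | T ω = (N : ℕ∞)}) := by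
    intro M N hMN
    rw [Function.onFun, Set.disjoint_left]
    intro ω h1 h2
    exact hMN (by exact_mod_cast (Eq.symm h1).trans h2)
  have h1 : P {ω | T ω ≠ ⊤} = 1 := by
    rw [hset, measure_iUnion hdisj hT]
    have h2 : ∀ N : ℕ, P {ω | T ω = (N : ℕ∞)} = ENNReal.ofReal (P.real {ω | T ω = (N : ℕ∞)}) :=
      fun N => (ENNReal.ofReal_toReal (measure_ne_top _ _)).symm
    rw [tsum_congr h2, ← ENNReal.ofReal_tsum_of_nonneg (fun _ => measureReal_nonneg) h.summable,
      h.tsum_eq, ENNReal.ofReal_one]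
  exact (mem_ae_iff_prob_eq_one hm).2 h1

theorem integral_pow_toNat (hT : ∀ N : ℕ, MeasurableSet {ω | T ω = (N : ℕ∞)})
    (htop : ∀ᵐ ω ∂P, T ω ≠ ⊤) {t : ℝ} (ht : |t| ≤ 1) {a : ℝ}
    (h : HasSum (fun N : ℕ => t ^ N * P.real {ω | T ω = (N : ℕ∞)}) a) :
    Integrable (fun ω => t ^ (T ω).toNat) P ∧ ∫ ω, t ^ (T ω).toNat ∂P = a := by
  have hTm : Measurable T := by
    refine measurable_to_countable' fun x => ?_
    cases x with
    | top =>
      have : T ⁻¹' {⊤} = (⋃ N : ℕ, {ω | T ω = (N : ℕ∞)})ᶜ := by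
        ext ω
        simp only [Set.mem_preimage, Set.mem_singleton_iff, Set.mem_compl_iff, Set.mem_iUnion,
          Set.mem_ofPred_eq, not_exists]
        rw [← not_iff_not, ← ne_eq, ENat.ne_top_iff_exists]
        simp [eq_comm]
      rw [this]
      exact (MeasurableSet.iUnion hT).compl
    | coe N => exact hT N
  have hNm : Measurable fun ω => (T ω).toNat := (Measurable.of_discrete (f := ENat.toNat)).comp hTm
  have hbound : ∀ n : ℕ, ‖t ^ n‖ ≤ 1 := fun n => by
    rw [norm_pow, Real.norm_eq_abs]
    exact pow_le_one₀ (abs_nonneg t) ht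
  have hpow : Measurable fun n : ℕ => t ^ n := Measurable.of_discrete
  refine ⟨Integrable.of_bound (hpow.comp hNm).aestronglyMeasurable 1
    (Filter.Eventually.of_forall fun ω => hbound _), ?_⟩
  have : IsProbabilityMeasure (P.map fun ω => (T ω).toNat) :=
    Measure.isProbabilityMeasure_map hNm.aemeasurable
  rw [← integral_map (φ := fun ω => (T ω).toNat) (f := fun n : ℕ => t ^ n) hNm.aemeasurable
    hpow.aestronglyMeasurable, integral_countable
    (Integrable.of_bound hpow.aestronglyMeasurable 1 (Filter.Eventually.of_forall hbound)),
    ← h.tsum_eq]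
  refine tsum_congr fun N => ?_
  rw [map_measureReal_apply hNm (measurableSet_singleton N), smul_eq_mul, mul_comm]
  congr 1
  rw [measureReal_def, measureReal_def]
  congr 1
  -- `ENat.toNat` sends ⊤ to 0, so the events T = N and `toNat` = N agree only off the null set T =
  -- ⊤.
  refine measure_congr ?_
  filter_upwards [htop] with ω hω
  obtain ⟨M, hM⟩ := ENat.ne_top_iff_exists.1 hω
  refine propext ⟨fun h => ?_, fun h => ?_⟩
  · have h1 : (T ω).toNat = N := h
    change T ω = N
    rw [← h1, ENat.natCast_toNat hω]
  · have h1 : T ω = N := h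
    change (T ω).toNat = N
    rw [h1, ENat.toNat_natCast]

end GeneratingFunction

theorem deg_ne_zero {V : Type*} [Fintype V] (G : ConnectionGraph V) (hconn : G.graph.Connected)
    [Nontrivial V] (x : V) : G.deg x ≠ 0 := by
  obtain ⟨y, hy⟩ := hconn.preconnected.exists_adj_of_nontrivial x
  refine (lt_of_lt_of_le (G.w_pos x y hy) ?_).ne'
  exact Finset.single_le_sum (fun z _ => w_nonneg x z) (Finset.mem_univ y)

theorem OrientedCycle.nontrivial {V : Type*} {G : ConnectionGraph V} (c : G.OrientedCycle) :
    Nontrivial V := by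
  obtain ⟨L, hL⟩ := Quotient.exists_rep c.1
  have h1 := c.2.1
  have h2 := c.2.2.1
  rw [← hL] at h1 h2
  match L, h1, h2 with
  | [], _, h2 => exact absurd (show 2 ≤ 0 from h2) (by norm_num)
  | [a], _, h2 => exact absurd (show 2 ≤ 1 from h2) (by norm_num)
  | a :: b :: L, h1, _ =>
    have h3 : (a :: b :: L).Nodup := Cycle.nodup_coe_iff.1 h1
    exact ⟨a, b, fun h => by simp [h] at h3⟩

end ConnectionGraph

end

theorem proposition4p6 {V : Type*} [Fintype V] [DecidableEq V] [MeasurableSpace V]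
    [DiscreteMeasurableSpace V]
    (G : ConnectionGraph V) (hconn : G.graph.Connected)
    -- the connection is non-trivial
    (hnontriv : ∃ c : G.OrientedCycle, c.hol ≠ 1)
    -- the cycles are weakly inconsistent
    (hweak : ∀ c : G.OrientedCycle, 0 ≤ Real.cos c.angle)
    (ι : Fin (Fintype.card V) ≃ V)
    {Ω : Type*} [MeasurableSpace Ω] (P : Measure Ω) [IsProbabilityMeasure P]
    (X : V → ℕ → Ω → V) (B : V → G.OrientedCycle → ℕ → Ω → Bool)
    (hinput : G.IsInput (fun c => 1 - Real.cos c.angle) P X B)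
    (T : Ω → ℕ∞)
    (hT : T = fun ω => G.runningTime ι (fun x n => X x n ω) (fun x c n => B x c n ω)) :
    (∀ᵐ ω ∂P, T ω ≠ ⊤) ∧
    (1 - G.transitionMatrix).det ≠ 0 ∧
    ∀ t : ℝ, t ∈ Set.Icc (-1 : ℝ) 1 →
      (1 - (t : ℂ) • G.transitionMatrix).det ≠ 0 ∧
      Integrable (fun ω => t ^ (T ω).toNat) P ∧
      ((∫ ω, t ^ (T ω).toNat ∂P : ℝ) : ℂ) =
        (t : ℂ) ^ Fintype.card V *
          ((1 + (1 - (t : ℂ)) •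
            (G.transitionMatrix * (1 - G.transitionMatrix)⁻¹)).det)⁻¹ ∧
      ((∫ ω, t ^ (T ω).toNat ∂P : ℝ) : ℂ) =
        (t : ℂ) ^ Fintype.card V *
          ((1 - G.transitionMatrix).det / (1 - (t : ℂ) • G.transitionMatrix).det) := by
  obtain ⟨c₀, hc₀⟩ := hnontriv
  -- A cycle has at least two nodes; with connectedness this makes every degree positive.
  have : Nontrivial V := c₀.nontrivial
  have hdeg := G.deg_ne_zero hconn
  have hQ : ∀ S, ConnectionGraph.IsTransient (G.pathMatrix S) :=
    ConnectionGraph.isTransient_pathMatrix hconn ⟨c₀, hc₀⟩ hdeg hweak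
  have hTeq : ∀ ω, T ω = G.remainingTime ι (fun x n => X x n ω) (fun x c n => B x c n ω)
      (Fintype.card V) ∅ := fun ω =>
    (congrFun hT ω).trans ConnectionGraph.runningTime_eq_remainingTime
  have hTm : ∀ N : ℕ, MeasurableSet {ω | T ω = (N : ℕ∞)} := fun N => by
    simp only [hTeq]
    exact ConnectionGraph.measurableSet_remainingTime _ (fun y _ => hinput.measurable_X y)
      (fun y _ => hinput.measurable_B y) N
  have hsum : ∀ t : ℝ, |t| ≤ 1 → HasSum (fun N : ℕ => t ^ N * P.real {ω | T ω = (N : ℕ∞)})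
      (t ^ Fintype.card V * G.cycleDet 1 Finset.univ / G.cycleDet t Finset.univ) := by
    intro t ht
    have h := ConnectionGraph.hasSum_remainingProb (ι := ι) hinput hdeg hQ ht
      (L := Fintype.card V) (A := ∅)
      (by rw [Finset.compl_empty, Finset.card_univ])
    rw [Finset.compl_empty, Finset.card_univ] at h
    simpa only [ConnectionGraph.remainingProb, hTeq] using h
  have hdet : ∀ t : ℝ, (1 - (t : ℂ) • G.transitionMatrix).det = (G.cycleDet t Finset.univ : ℂ) :=
    fun t => by rw [ConnectionGraph.ofReal_cycleDet hdeg, ConnectionGraph.principalDet_univ]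
  have hD : ∀ t : ℝ, |t| ≤ 1 → (1 - (t : ℂ) • G.transitionMatrix).det ≠ 0 := fun t ht => by
    rw [hdet]
    exact_mod_cast ConnectionGraph.cycleDet_ne_zero hdeg hQ ht Finset.univ
  have hdet1 : (1 - G.transitionMatrix).det = (G.cycleDet 1 Finset.univ : ℂ) := by
    simpa using hdet 1
  have hD1 : (1 - G.transitionMatrix).det ≠ 0 := by simpa using hD 1 (by simp)
  have htop : ∀ᵐ ω ∂P, T ω ≠ ⊤ := by
    refine ConnectionGraph.ae_ne_top_of_hasSum hTm ?_
    have h := hsum 1 (by simp)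
    rw [one_pow, one_mul, div_self (ConnectionGraph.cycleDet_ne_zero hdeg hQ (by simp) _)] at h
    simpa only [one_pow, one_mul] using h
  refine ⟨htop, hD1, fun t ht => ?_⟩
  have ht' : |t| ≤ 1 := abs_le.2 ht
  obtain ⟨hint, hval⟩ := ConnectionGraph.integral_pow_toNat hTm htop ht' (hsum t ht')
  have hquot : ((∫ ω, t ^ (T ω).toNat ∂P : ℝ) : ℂ) = (t : ℂ) ^ Fintype.card V *
      ((1 - G.transitionMatrix).det / (1 - (t : ℂ) • G.transitionMatrix).det) := by
    rw [hval, hdet, hdet1]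
    push_cast
    ring
  refine ⟨hD t ht', hint, ?_, hquot⟩
  -- Writing I as (I - Π)(I - Π)⁻¹, the left factors add up to (I - Π) + (1 - t)Π = I - tΠ.
  have hfac : 1 + (1 - (t : ℂ)) • (G.transitionMatrix * (1 - G.transitionMatrix)⁻¹) =
      (1 - (t : ℂ) • G.transitionMatrix) * (1 - G.transitionMatrix)⁻¹ := by
    rw [← Matrix.smul_mul]
    nth_rw 1 [← Matrix.mul_nonsing_inv _ (isUnit_iff_ne_zero.2 hD1)]
    rw [← Matrix.add_mul]
    congr 1
    rw [sub_smul, one_smul]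
    abel
  rw [hquot, hfac, Matrix.det_mul, Matrix.det_nonsing_inv, Ring.inverse_eq_inv', mul_inv, inv_inv]
  ring
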